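/- Let $K$ be an algebraically closed field of characteristic $0$ and $$p(x,y)=x^6y^5-5x^5y^4+10x^4y^3-2x^3y^3-10x^3y^2+5x^2y^2+5x^2y-\tfrac{15}{4}xy-x+y ,$$ equivalently $p=(x^3y^2-1)^2y+(xy-1)^5x-x^6y^5+5xy\left(xy-\tfrac34\right)$. For $f\in K[x,y]$ of degree $D$ and a point $P$ of the line at infinity $z=0$ of $\mathbb P^2$, write the rational function $f$ near $P$ as $f_P/z^D$, with $f_P$ a local equation at $P$ of the closure of the curve $f=0$. The branches at infinity of the curve $f=0$ are the irreducible factors, up to units and counted without multiplicity, of the $f_P\in K[[s,z]]$ for all points $P$ at infinity ($s$ being a local coordinate at $P$ on the line at infinity). A dicritical of $f$ at infinity is an exceptional curve $E$ of a sequence of point blow-ups over a point $P$ at infinity such that the pull-back of $f$ to $E$ is not constant; $d_E$ is the degree of the resulting map $E\to\mathbb P^1$. For $t\in K$, take the strict transform of the germ $f_P-tz^D=0$ on the surface on which $E$ is created. The value $t$ is typical at $E$ if this strict transform meets $E$ in exactly $d_E$ points and is nonsingular and transversal to $E$ at each of them; otherwise $t$ is atypical at $E$. A critical value of $f$ at infinity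 is a $t\in K$ that is atypical at some dicritical of $f$ at infinity. Then: 1. $p$ has exactly two dicriticals at infinity, one over $[0:1:0]$ and one over $[1:0:0]$, both of degree $1$. The only atypical value at the first is $-\tfrac58$, and the only atypical value at the second is $-\tfrac34$. Hence the set of critical values of $p$ at infinity is $\{-\tfrac58,-\tfrac34\}$, and $p$ has exactly two nonzero critical values at infinity. 2. The curve $p=0$ has exactly two branches at infinity. So the number of nonzero critical values of $p$ at infinity equals the number of branches at infinity of $p=0$: Gwoździewicz's bound (if the curve $f=0$ has $n$ branches at infinity, then $f$ has at most $n$ nonzero critical values at infinity) is attained, and his question, whether there is a polynomial $f$ with $n$ nonzero critical values at infinity such that the curve $f=0$ has $n$ branches at infinity, has an affirmative answer (with $n=2$). 3. The curve $p=t$ has exactly two branches at infinity for every $t\in K\setminus\{-\tfrac58,-\tfrac34\}$, and exactly three for $t=-\tfrac58$ and for $t=-\tfrac34$. 4. The only point of the affine plane at which a fibre of $p$ is singular is $\left(-900,-\tfrac4{3375}\right)$. It lies on the fibre $p=-\tfrac{20}{27}$, which has an ordinary double point there. -/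

import Mathlib

/-!
Local coordinates at a point are always `X 0, X 1`; germs at the origin of the plane are given by
polynomials in these two coordinates. A direction at the origin (a point of the exceptional curve of
the blow-up of the origin) is an element of `Option K`: `some c` is the direction of the line
`X 1 = c * X 0`, and `none` is the direction of the line `X 0 = 0`.
-/

namespace AtInfinity

noncomputable section

variable {K : Type*} [Field K]

/-! ### The germs of an affine curve at the points at infinity -/

/-- The local equation at a point of the line at infinity of the closure in `ℙ²` of the affine curve
`f = 0`, where `[x : y : 1]` is the point `(x, y)`. At `[1 : c : 0]` (written `some c`) it is
`z ^ D * f (1 / z, (s + c) / z)`, at `[0 : 1 : 0]` (written `none`) it is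
`z ^ D * f (s / z, 1 / z)`, with `s = X 0`, `z = X 1` and `D = deg f`. The line at infinity is
`z = 0`. -/
def germ (f : MvPolynomial (Fin 2) K) : Option K → MvPolynomial (Fin 2) K
  | some c => f.support.sum fun m =>
      MvPolynomial.C (f.coeff m) * (MvPolynomial.X 0 + MvPolynomial.C c) ^ (m 1) *
        MvPolynomial.X 1 ^ (f.totalDegree - (m 0 + m 1))
  | none => f.support.sum fun m =>
      MvPolynomial.C (f.coeff m) * MvPolynomial.X 0 ^ (m 0) *
        MvPolynomial.X 1 ^ (f.totalDegree - (m 0 + m 1))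

/-- The germ at every point at infinity of the denominator of the rational function `f` on `ℙ²`,
namely `z ^ D`. The rational function is `germ f a / poleGerm f`. -/
def poleGerm (f : MvPolynomial (Fin 2) K) : MvPolynomial (Fin 2) K :=
  MvPolynomial.X 1 ^ f.totalDegree

/-- The member of parameter `t` of the pencil of `f` at the point `a` at infinity: a local equation
of the closure of the fibre `f = t`. -/
def fibreGerm (f : MvPolynomial (Fin 2) K) (a : Option K) (t : K) : MvPolynomial (Fin 2) K :=
  germ f a - MvPolynomial.C t * poleGerm f

/-- The branches at infinity of the affine curve `g = 0`: pairs of a point `a` at infinity and an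
irreducible factor (up to units) in `K⟦s, z⟧` of the local equation at `a`. -/
def branchesAtInfinity (g : MvPolynomial (Fin 2) K) :
    Set (Option K × Associates (MvPowerSeries (Fin 2) K)) :=
  {b | Irreducible b.2 ∧ b.2 ∣ Associates.mk (germ g b.1 : MvPowerSeries (Fin 2) K)}

/-! ### Blow-ups and infinitely near points -/

/-- The order of vanishing at the origin (for a nonzero polynomial). -/
def ord (F : MvPolynomial (Fin 2) K) : ℕ :=
  sInf {n | MvPolynomial.homogeneousComponent n F ≠ 0}

/-- The blow-up of the origin, in coordinates centred at the point of the exceptional curve of the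
given direction. -/
def blowUp : Option K → MvPolynomial (Fin 2) K →ₐ[K] MvPolynomial (Fin 2) K
  | some c => MvPolynomial.aeval
      ![MvPolynomial.X 0, MvPolynomial.X 0 * (MvPolynomial.X 1 + MvPolynomial.C c)]
  | none => MvPolynomial.aeval
      ![MvPolynomial.X 0 * MvPolynomial.X 1, MvPolynomial.X 1]

/-- In the coordinates of `blowUp d`, the exceptional curve is `X (excIndex d) = 0`. -/
def excIndex : Option K → Fin 2
  | some _ => 0
  | none => 1

/-- In the coordinates of `blowUp d`, the restriction of `X (tangentIndex d)` is a local coordinate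
on the exceptional curve. -/
def tangentIndex : Option K → Fin 2
  | some _ => 1
  | none => 0

/-- The strict transform of the curve germ `F = 0` at the point of direction `d` of the exceptional
curve: `F ∘ blowUp d`, divided by the equation of the exceptional curve to the power `ord F`. -/
def strictStep (F : MvPolynomial (Fin 2) K) (d : Option K) : MvPolynomial (Fin 2) K :=
  (blowUp d F).divMonomial (Finsupp.single (excIndex d) (ord F))

/-- A list `w` of directions is a point infinitely near to the origin: each entry is a point of the
exceptional curve of the blow-up of the preceding point (`[]` is the origin itself). This is the
pull-back of `F` to that point. -/
def totalTransform (w : List (Option K)) (F : MvPolynomial (Fin 2) K) : MvPolynomial (Fin 2) K :=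
  w.foldl (fun G d => blowUp d G) F

/-- The strict transform of the germ `F = 0` at the infinitely near point `w`. -/
def strictTransform (w : List (Option K)) (F : MvPolynomial (Fin 2) K) :
    MvPolynomial (Fin 2) K :=
  w.foldl strictStep F

/-! ### Dicritical divisors

The exceptional divisors over the origin are the curves `E_w`, for `w` an infinitely near point:
`E_w` is the exceptional curve of the blow-up of `w`. The points of `E_w` are the `w ++ [d]`. -/

/-- The lowest order form of `F`, in the affine coordinate `v = X 1 / X 0` on the exceptional curve
of the blow-up of the origin. -/
def initialPoly (F : MvPolynomial (Fin 2) K) : Polynomial K :=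
  MvPolynomial.aeval ![1, Polynomial.X] (MvPolynomial.homogeneousComponent (ord F) F)

/-- The quotient of the lowest order forms of the pull-backs of `P` and `Q` to `w`, as a rational
function on `E_w`. If these pull-backs have the same order, it is the restriction of `P / Q` to
`E_w`; otherwise `P / Q` is identically `0` or `∞` on `E_w`. -/
def restrictTo (w : List (Option K)) (P Q : MvPolynomial (Fin 2) K) : RatFunc K :=
  algebraMap (Polynomial K) (RatFunc K) (initialPoly (totalTransform w P)) /
    algebraMap (Polynomial K) (RatFunc K) (initialPoly (totalTransform w Q))

/-- `E_w`, over the point `a` at infinity, is a dicritical of `f` at infinity: the pull-back of the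
rational function `f` is not constant on `E_w`. -/
def IsDicritical (f : MvPolynomial (Fin 2) K) (a : Option K) (w : List (Option K)) : Prop :=
  ord (totalTransform w (germ f a)) = ord (totalTransform w (poleGerm f)) ∧
    restrictTo w (germ f a) (poleGerm f) ∉ Set.range (RatFunc.C : K →+* RatFunc K)

/-- The degree of the map `E_w → ℙ¹` given by `f` on a dicritical `E_w`. -/
def dicriticalDegree (f : MvPolynomial (Fin 2) K) (a : Option K) (w : List (Option K)) : ℕ :=
  max (restrictTo w (germ f a) (poleGerm f)).num.natDegree
    (restrictTo w (germ f a) (poleGerm f)).denom.natDegree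

/-- The strict transform of the germ `F = 0` passes through the point `w ++ [d]` of `E_w`. -/
def MeetsAt (F : MvPolynomial (Fin 2) K) (w : List (Option K)) (d : Option K) : Prop :=
  MvPolynomial.constantCoeff (strictTransform (w ++ [d]) F) = 0

/-- At the point `w ++ [d]` of `E_w`, the strict transform of `F = 0` is a curvette of `E_w`: a
nonsingular germ transversal to `E_w`. Given that the germ passes through the point, this says that
its restriction to `E_w` vanishes to order exactly one. -/
def IsCurvetteAt (F : MvPolynomial (Fin 2) K) (w : List (Option K)) (d : Option K) : Prop :=
  MeetsAt F w d ∧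
    MvPolynomial.coeff (Finsupp.single (tangentIndex d) 1) (strictTransform (w ++ [d]) F) ≠ 0

/-- `t` is a typical value of `f` at `E_w`: the strict transform of the fibre `f = t` meets `E_w` in
exactly as many points as the degree of `f` on `E_w`, and it is a curvette at each of them. -/
def IsTypicalAt (f : MvPolynomial (Fin 2) K) (a : Option K) (w : List (Option K)) (t : K) : Prop :=
  {d | MeetsAt (fibreGerm f a t) w d}.encard = dicriticalDegree f a w ∧
    ∀ d, MeetsAt (fibreGerm f a t) w d → IsCurvetteAt (fibreGerm f a t) w d

/-- `t` is a critical (or atypical) value of `f` at infinity: it is not typical at some dicritical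
of `f` at infinity. -/
def IsCriticalValueAtInfinity (f : MvPolynomial (Fin 2) K) (t : K) : Prop :=
  ∃ a w, IsDicritical f a w ∧ ¬ IsTypicalAt f a w t

/-! ### Affine singularities -/

/-- The fibre of `f` through `v` is singular at `v`. -/
def IsSingularAt (f : MvPolynomial (Fin 2) K) (v : Fin 2 → K) : Prop :=
  ∀ i, MvPolynomial.eval v (MvPolynomial.pderiv i f) = 0

/-- The Hessian matrix of `f` at `v`. -/
def hessian (f : MvPolynomial (Fin 2) K) (v : Fin 2 → K) : Matrix (Fin 2) (Fin 2) K :=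
  Matrix.of fun i j => MvPolynomial.eval v (MvPolynomial.pderiv i (MvPolynomial.pderiv j f))

/-- The fibre of `f` through `v` has an ordinary double point at `v` (in characteristic not two). -/
def IsOrdinaryDoublePoint (f : MvPolynomial (Fin 2) K) (v : Fin 2 → K) : Prop :=
  IsSingularAt f v ∧ (hessian f v).det ≠ 0

/-! ### The polynomial -/

variable (K) in
/-- `x⁶y⁵ - 5x⁵y⁴ + 10x⁴y³ - 2x³y³ - 10x³y² + 5x²y² + 5x²y - (15/4)xy - x + y`. -/
def p : MvPolynomial (Fin 2) K :=
  let x : MvPolynomial (Fin 2) K := MvPolynomial.X 0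
  let y : MvPolynomial (Fin 2) K := MvPolynomial.X 1
  x ^ 6 * y ^ 5 - 5 * x ^ 5 * y ^ 4 + 10 * x ^ 4 * y ^ 3 - 2 * x ^ 3 * y ^ 3 - 10 * x ^ 3 * y ^ 2
    + 5 * x ^ 2 * y ^ 2 + 5 * x ^ 2 * y - MvPolynomial.C (15 / 4) * x * y - x + y

end

end AtInfinity

/-! Everything rests on the form p = x(xy-1)^5 + g(xy) + y with g(u) = -2u^3 + 5u^2 - (15/4)u. The
top form is x^6y^5, so the fibres meet the line at infinity only at [1:0:0] and [0:1:0].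

Branches. At [1:0:0], put z = 1/x, s = y/x = z^2 u. The fibre p = t becomes (u-1)^5 = z(t - g(u)) -
z^2 u, so u - 1 has order 1/5 in z unless t = g(1) = -3/4. In that case the branch of degree 5 over
the z-line splits into one of degree 4 and a smooth one. At [0:1:0], put z = 1/y, s = x/y. The
leading part is (s^3 - z^5)^2, and s = z^(5/3)(1 + B z^(1/3) + c z^(1/2) + ...), where B is a root
of 9B^2 - 15B + 10 - 15/4. The coefficient 15/4 makes this the square (3B - 5/2)^2, so B = 5/6, and
then 9c^2 = t + 5/8. For t = -5/8 the branch of degree 6 splits into two of degree 3. The series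
come from Hensel's lemma. A series in τ, z = τ^n, has n conjugates under τ ↦ ωτ, which bounds the
degree of its minimal polynomial over K⟦z⟧ from below. Comparison with the degree of the local
equation, a Weierstrass polynomial in s, gives its factorization (`encard_localBranches_eq_one`,
`encard_localBranches_eq_two`).

Dicriticals. The pencil is followed through blow-ups. At each stage the tangent cone of the
numerator is a power of one linear form, and its degree does not exceed the order of the
denominator; hence only one direction can carry a dicritical (`Leads.cons`). After six blow-ups p is
a quotient of two transversal coordinates, and the next blow-up creates the only dicritical, of
degree 1 (`Leads.isDicritical_iff`). The strict transform of a general fibre is a curvette there;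
for the exceptional t its multiplicity is too large at one of the earlier points, and it misses the
dicritical.

Singular points. With q = xy - 1, the operator x∂x - y∂y kills g(xy) and gives xq^5 = y; elimination
of x leaves a linear equation in q. -/

open Polynomial Ring in
/-- Hensel's lemma for adically complete rings, without the assumption that the polynomial is
monic. -/
theorem IsAdicComplete.exists_isRoot_of_isUnit_derivative {R : Type*} [CommRing R] (I : Ideal R)
    [IsAdicComplete I R] (f : R[X]) (a₀ : R) (h₁ : f.eval a₀ ∈ I)
    (h₂ : IsUnit (Ideal.Quotient.mk I (f.derivative.eval a₀))) :
    ∃ a : R, f.IsRoot a ∧ a - a₀ ∈ I := by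
  classical
  let f' := derivative f
  -- we define a sequence `c n` by starting at `a₀` and then continually
  -- applying the function sending `b` to `b - f(b)/f'(b)` (Newton's method).
  -- Note that `f'.eval b` is a unit, because `b` has the same residue as `a₀` modulo `I`.
  let c : ℕ → R := fun n => Nat.recOn n a₀ fun _ b => b - f.eval b * (f'.eval b)⁻¹ʳ
  have hc : ∀ n, c (n + 1) = c n - f.eval (c n) * (f'.eval (c n))⁻¹ʳ := by
    intro n
    simp only [c]
  -- we now spend some time determining properties of the sequence `c : ℕ → R`
  -- `hc_mod`: for every `n`, we have `c n ≡ a₀ [SMOD I]`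
  -- `hf'c`  : for every `n`, `f'.eval (c n)` is a unit
  -- `hfcI`  : for every `n`, `f.eval (c n)` is contained in `I ^ (n+1)`
  have hc_mod : ∀ n, c n ≡ a₀ [SMOD I] := by
    intro n
    induction n with
    | zero => rfl
    | succ n ih => ?_
    rw [hc, sub_eq_add_neg, ← add_zero a₀]
    refine ih.add ?_
    rw [SModEq.zero, Ideal.neg_mem_iff]
    refine I.mul_mem_right _ ?_
    rw [← SModEq.zero] at h₁ ⊢
    exact (ih.eval f).trans h₁
  have hf'c : ∀ n, IsUnit (f'.eval (c n)) := by
    intro n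
    have := isLocalHom_of_le_jacobson_bot I (IsAdicComplete.le_jacobson_bot I)
    apply IsUnit.of_map (Ideal.Quotient.mk I)
    convert! h₂ using 1
    exact SModEq.def.mp ((hc_mod n).eval _)
  have hfcI : ∀ n, f.eval (c n) ∈ I ^ (n + 1) := by
    intro n
    induction n with
    | zero => simpa only [Nat.rec_zero, zero_add, pow_one] using! h₁
    | succ n ih => ?_
    rw [← taylor_eval_sub (c n), hc, sub_eq_add_neg, sub_eq_add_neg,
      add_neg_cancel_comm]
    rw [eval_eq_sum, sum_over_range' _ _ _ (lt_add_of_pos_right _ zero_lt_two), ←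
      Finset.sum_range_add_sum_Ico _ (Nat.le_add_left _ _)]
    swap
    · intro i
      rw [zero_mul]
    refine Ideal.add_mem _ ?_ ?_
    · rw [← one_add_one_eq_two, Finset.sum_range_succ, Finset.range_one, Finset.sum_singleton,
        taylor_coeff_zero, taylor_coeff_one, pow_zero, pow_one, mul_one, mul_neg,
        mul_left_comm, Ring.mul_inverse_cancel _ (hf'c n), mul_one, add_neg_cancel]
      exact Ideal.zero_mem _
    · refine Submodule.sum_mem _ ?_
      simp only [Finset.mem_Ico]
      rintro i ⟨h2i, _⟩
      have aux : n + 2 ≤ i * (n + 1) := by trans 2 * (n + 1) <;> nlinarith only [h2i]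
      refine Ideal.mul_mem_left _ _ (Ideal.pow_le_pow_right aux ?_)
      rw [pow_mul']
      exact Ideal.pow_mem_pow ((Ideal.neg_mem_iff _).2 <| Ideal.mul_mem_right _ _ ih) _
  -- we are now in the position to show that `c : ℕ → R` is a Cauchy sequence
  have aux : ∀ m n, m ≤ n → c m ≡ c n [SMOD (I ^ m • ⊤ : Ideal R)] := by
    intro m n hmn
    rw [← Ideal.one_eq_top, Ideal.smul_eq_mul, mul_one]
    obtain ⟨k, rfl⟩ := Nat.exists_eq_add_of_le hmn
    clear hmn
    induction k with
    | zero => rw [add_zero]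
    | succ k ih => ?_
    rw [← add_assoc, hc, ← add_zero (c m), sub_eq_add_neg]
    refine ih.add ?_
    symm
    rw [SModEq.zero, Ideal.neg_mem_iff]
    refine Ideal.mul_mem_right _ _ (Ideal.pow_le_pow_right ?_ (hfcI _))
    rw [add_assoc]
    exact le_self_add
  -- hence the sequence converges to some limit point `a`, which is the `a` we are looking for
  obtain ⟨a, ha⟩ := IsPrecomplete.prec' c (aux _ _)
  refine ⟨a, ?_, ?_⟩
  · show f.IsRoot a
    suffices ∀ n, f.eval a ≡ 0 [SMOD (I ^ n • ⊤ : Ideal R)] by exact IsHausdorff.haus' _ this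
    intro n
    specialize ha n
    rw [← Ideal.one_eq_top, Ideal.smul_eq_mul, mul_one] at ha ⊢
    refine (ha.symm.eval f).trans ?_
    rw [SModEq.zero]
    exact Ideal.pow_le_pow_right le_self_add (hfcI _)
  · show a - a₀ ∈ I
    specialize ha (0 + 1)
    rw [hc, pow_one, ← Ideal.one_eq_top, Ideal.smul_eq_mul, mul_one, sub_eq_add_neg] at ha
    rw [← SModEq.sub_mem, ← add_zero a₀]
    refine ha.symm.trans (SModEq.rfl.add ?_)
    rw [SModEq.zero, Ideal.neg_mem_iff]
    exact Ideal.mul_mem_right _ _ h₁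

/-! ### Conjugates of ramified power series; Weierstrass polynomials. -/

namespace AtInfinity

noncomputable section

open Polynomial

variable {K : Type*} [Field K]

/-- The power series in `τ`, as an algebra over the power series in `z = τ ^ n`. -/
def Ramified (K : Type*) (_ : ℕ) : Type _ := PowerSeries K

namespace Ramified

variable {n : ℕ}

/-- A power series, as an element of `Ramified K n`. -/
def of (n : ℕ) (σ : PowerSeries K) : Ramified K n := σ

instance : CommRing (Ramified K n) := inferInstanceAs (CommRing (PowerSeries K))

instance : IsDomain (Ramified K n) := inferInstanceAs (IsDomain (PowerSeries K))

instance [NeZero n] : Algebra (PowerSeries K) (Ramified K n) :=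
  (PowerSeries.expand n (NeZero.ne n) : PowerSeries K →ₐ[K] PowerSeries K).toRingHom.toAlgebra

theorem algebraMap_apply [NeZero n] (f : PowerSeries K) :
    algebraMap (PowerSeries K) (Ramified K n) f = PowerSeries.expand n (NeZero.ne n) f := rfl

theorem algebraMap_injective [NeZero n] :
    Function.Injective (algebraMap (PowerSeries K) (Ramified K n)) := by
  rw [injective_iff_map_eq_zero]
  intro f hf
  ext m
  have := congrArg (PowerSeries.coeff (n * m)) ((algebraMap_apply f).symm.trans hf)
  rw [PowerSeries.coeff_expand_mul] at this
  exact this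

instance [NeZero n] : Module.IsTorsionFree (PowerSeries K) (Ramified K n) :=
  Module.isTorsionFree_iff_algebraMap_injective.2 algebraMap_injective

end Ramified

/-- The substitution `τ ↦ ω τ` fixes the power series in `τ ^ n` when `ω ^ n = 1`. -/
theorem rescale_expand {n : ℕ} (hn : n ≠ 0) {ω : K} (hω : ω ^ n = 1) (f : PowerSeries K) :
    PowerSeries.rescale ω (PowerSeries.expand n hn f) = PowerSeries.expand n hn f := by
  ext m
  rw [PowerSeries.coeff_rescale]
  by_cases h : n ∣ m
  · obtain ⟨k, rfl⟩ := h
    rw [pow_mul, hω, one_pow, one_mul]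
  · rw [PowerSeries.coeff_expand_of_not_dvd _ _ _ h, mul_zero]

/-- The conjugates of `σ` over the power series in `τ ^ n`. -/
def conjugates (n : ℕ) (σ : PowerSeries K) : Finset (PowerSeries K) :=
  open Classical in
  (nthRootsFinset n (1 : K)).image fun ω => PowerSeries.rescale ω σ

theorem mem_conjugates {n : ℕ} [NeZero n] {σ s : PowerSeries K} :
    s ∈ conjugates n σ ↔ ∃ ω : K, ω ^ n = 1 ∧ PowerSeries.rescale ω σ = s := by
  simp [conjugates, mem_nthRootsFinset (NeZero.pos n)]

/-- If `σ` involves `τ ^ k` with `k` prime to `n`, then `σ` has `n` conjugates over the power series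
in `τ ^ n`. -/
theorem card_conjugates [IsAlgClosed K] [CharZero K] {n : ℕ} [NeZero n]
    {σ : PowerSeries K} {k : ℕ} (hk : n.Coprime k) (hσ : PowerSeries.coeff k σ ≠ 0) :
    (conjugates n σ).card = n := by
  classical
  obtain ⟨ζ, hζ⟩ := HasEnoughRootsOfUnity.exists_primitiveRoot K n
  rw [conjugates, Finset.card_image_of_injOn, hζ.card_nthRootsFinset]
  intro a ha b hb hab
  rw [Finset.mem_coe, mem_nthRootsFinset (NeZero.pos n)] at ha hb
  have h1 := congrArg (PowerSeries.coeff k) hab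
  simp only [PowerSeries.coeff_rescale] at h1
  have h2 := mul_right_cancel₀ hσ h1
  have hb0 : b ≠ 0 := by
    rintro rfl
    simp [NeZero.ne n] at hb
  have h3 : (a / b) ^ k = 1 := by rw [div_pow, h2, div_self (pow_ne_zero _ hb0)]
  have h4 : (a / b) ^ n = 1 := by rw [div_pow, ha, hb, div_one]
  have h5 : (a / b) ^ n.gcd k = 1 := pow_gcd_eq_one.2 ⟨h4, h3⟩
  rw [hk, pow_one] at h5
  exact (div_eq_one_iff_eq hb0).1 h5

/-- The substitution τ ↦ ωτ is a ring automorphism fixing the coefficients of G, which are series in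
τ^n, so it permutes the roots of G. -/
theorem aeval_of_mem_conjugates {n : ℕ} [NeZero n] {σ s : PowerSeries K}
    {G : (PowerSeries K)[X]} (h : aeval (Ramified.of n σ) G = 0) (hs : s ∈ conjugates n σ) :
    aeval (Ramified.of n s) G = 0 := by
  obtain ⟨ω, hω, rfl⟩ := mem_conjugates.1 hs
  let φ : PowerSeries K →+* PowerSeries K :=
    (PowerSeries.expand n (NeZero.ne n) : PowerSeries K →ₐ[K] PowerSeries K).toRingHom
  have h0 : eval₂ φ σ G = 0 := h
  have h1 := congrArg (PowerSeries.rescale ω) h0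
  rw [hom_eval₂, map_zero] at h1
  have h2 : (PowerSeries.rescale ω).comp φ = φ := by
    ext1 f
    exact rescale_expand (NeZero.ne n) hω f
  rwa [h2] at h1

theorem card_le_natDegree {n : ℕ} [NeZero n] {S : Finset (PowerSeries K)}
    {G : (PowerSeries K)[X]} (hG : G.Monic)
    (h : ∀ s ∈ S, aeval (Ramified.of n s) G = 0) : S.card ≤ G.natDegree := by
  classical
  let φ : PowerSeries K →+* PowerSeries K :=
    (PowerSeries.expand n (NeZero.ne n) : PowerSeries K →ₐ[K] PowerSeries K).toRingHom
  have hsub : S ⊆ (G.map φ).roots.toFinset := by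
    intro s hs
    rw [Multiset.mem_toFinset, mem_roots (hG.map φ).ne_zero, IsRoot, eval_map]
    exact h s hs
  calc S.card ≤ _ := Finset.card_le_card hsub
    _ ≤ _ := Multiset.toFinset_card_le _
    _ ≤ (G.map φ).natDegree := card_roots' _
    _ ≤ G.natDegree := natDegree_map_le

/-- The cubic equation over the power series in `τ ^ 3` of a power series in `τ`. -/
theorem exists_monic_cubic (σ : PowerSeries K) :
    ∃ H : (PowerSeries K)[X], H.Monic ∧ H.natDegree = 3 ∧ aeval (Ramified.of 3 σ) H = 0 := by
  let part (i : ℕ) : PowerSeries K := PowerSeries.mk fun m => PowerSeries.coeff (3 * m + i) σ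
  let φ : PowerSeries K →+* PowerSeries K :=
    (PowerSeries.expand 3 three_ne_zero : PowerSeries K →ₐ[K] PowerSeries K).toRingHom
  have hφ : ∀ f m, PowerSeries.coeff m (φ f) = if 3 ∣ m then PowerSeries.coeff (m / 3) f else 0 :=
    fun f m => PowerSeries.coeff_expand ..
  have hX : φ PowerSeries.X = PowerSeries.X ^ 3 := PowerSeries.expand_X _ _
  -- The exponents are sorted by residue modulo 3: σ = a + bτ + cτ^2 with a, b, c series in τ^3.
  have hσ : σ = φ (part 0) + φ (part 1) * PowerSeries.X ^ 1 + φ (part 2) * PowerSeries.X ^ 2 := by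
    ext m
    simp only [map_add, PowerSeries.coeff_mul_X_pow', hφ, part, PowerSeries.coeff_mk]
    obtain ⟨q, rfl | rfl | rfl⟩ : ∃ q, m = 3 * q ∨ m = 3 * q + 1 ∨ m = 3 * q + 2 :=
      ⟨m / 3, by omega⟩
    · have h1 : ¬ (1 ≤ 3 * q ∧ 3 ∣ 3 * q - 1) := by omega
      have h2 : ¬ (2 ≤ 3 * q ∧ 3 ∣ 3 * q - 2) := by omega
      simp only [← ite_and, if_neg h1, if_neg h2]
      simp
    · have h1 : ¬ (3 ∣ 3 * q + 1) := by omega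
      have h2 : ¬ (2 ≤ 3 * q + 1 ∧ 3 ∣ 3 * q + 1 - 2) := by omega
      simp only [← ite_and, if_neg h1, if_neg h2]
      simp
    · have h1 : ¬ (3 ∣ 3 * q + 2) := by omega
      have h2 : ¬ (1 ≤ 3 * q + 2 ∧ 3 ∣ 3 * q + 2 - 1) := by omega
      simp only [← ite_and, if_neg h1, if_neg h2]
      simp
  generalize part 0 = a, part 1 = b, part 2 = c at hσ
  -- X^3 + R is the norm of X - a - bτ - cτ^2 for τ^3 = z, that is, (X-a)^3 - 3zbc(X-a) - zb^3 -
  -- z^2c^3.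
  let R : (PowerSeries K)[X] := C (-(3 * a)) * X ^ 2 + C (3 * a ^ 2 - 3 * PowerSeries.X * b * c) * X
    + C (- a ^ 3 + 3 * PowerSeries.X * a * b * c - PowerSeries.X * b ^ 3 - PowerSeries.X ^ 2 * c ^ 3)
  have hR : R.degree < (3 : ℕ) := lt_of_le_of_lt degree_quadratic_le (by norm_num)
  refine ⟨X ^ 3 + R, monic_X_pow_add hR, ?_, ?_⟩
  · exact natDegree_eq_of_degree_eq_some (degree_eq_of_le_of_coeff_ne_zero
      ((degree_add_le _ _).trans (max_le (degree_X_pow_le 3) hR.le))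
      (by rw [coeff_add, coeff_eq_zero_of_degree_lt hR]; simp))
  · change eval₂ φ σ (X ^ 3 + R) = 0
    simp only [R, eval₂_add, eval₂_mul, eval₂_pow, eval₂_X, eval₂_C]
    simp only [map_add, map_sub, map_mul, map_pow, map_neg, map_ofNat, hX]
    rw [hσ]
    ring

/-- Modulo z the polynomial F becomes a power of X, and a monic divisor of a power of X is a power
of X. -/
theorem isDistinguishedAt_of_dvd {F G : (PowerSeries K)[X]}
    (hF : F.IsDistinguishedAt (Ideal.span {PowerSeries.X})) (hG : G.Monic) (h : G ∣ F) :
    G.IsDistinguishedAt (Ideal.span {PowerSeries.X}) := by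
  have hmem : ∀ f : PowerSeries K, f ∈ Ideal.span {(PowerSeries.X : PowerSeries K)} ↔
      PowerSeries.constantCoeff f = 0 := fun f => by
    rw [Ideal.mem_span_singleton, PowerSeries.X_dvd_iff]
  have hmap : F.map (PowerSeries.constantCoeff (R := K)) = X ^ F.natDegree := by
    ext i
    rw [coeff_map, coeff_X_pow]
    split_ifs with hi
    · rw [hi, hF.monic.coeff_natDegree, map_one]
    · rcases lt_or_gt_of_ne hi with hi | hi
      · exact (hmem _).1 (hF.mem hi)
      · rw [coeff_eq_zero_of_natDegree_lt hi, map_zero]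
  have hdvd := map_dvd (mapRingHom (PowerSeries.constantCoeff (R := K))) h
  rw [coe_mapRingHom, hmap] at hdvd
  obtain ⟨j, hj, hass⟩ := (dvd_prime_pow prime_X _).1 hdvd
  have heq : G.map (PowerSeries.constantCoeff (R := K)) = X ^ j :=
    eq_of_monic_of_associated (hG.map _) (monic_X_pow j) hass
  have hdeg : j = G.natDegree := by
    rw [← hG.natDegree_map (PowerSeries.constantCoeff (R := K)), heq, natDegree_X_pow]
  refine ⟨⟨fun {i} hi => (hmem _).2 ?_⟩, hG⟩
  rw [← coeff_map, heq, coeff_X_pow, if_neg (by omega)]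

/-- A distinguished polynomial that is prime as a polynomial is prime as a power series. -/
theorem prime_coe_of_isDistinguishedAt {A : Type*} [CommRing A] [IsDomain A] {I : Ideal A}
    [IsAdicComplete I A] {G : A[X]} (hG : G.IsDistinguishedAt I) (hp : Prime G) :
    Prime (G : PowerSeries A) := by
  -- By Weierstrass division A[X]/(G) and A⟦X⟧/(G) are isomorphic, so both are domains as soon as
  -- one is.
  have e := hG.algEquivQuotient
  have h0 : (G : PowerSeries A) ≠ 0 := by
    rw [Ne, Polynomial.coe_eq_zero_iff]
    exact hp.ne_zero
  have h1 : (Ideal.span {G}).IsPrime := (Ideal.span_singleton_prime hp.ne_zero).2 hp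
  rw [← Ideal.span_singleton_prime h0, ← Ideal.Quotient.isDomain_iff_prime]
  have := (Ideal.Quotient.isDomain_iff_prime _).2 h1
  exact e.symm.toMulEquiv.isDomain _

/-- The isomorphism A[X]/(G) ≅ A⟦X⟧/(G) of Weierstrass division is injective. This keeps distinct
polynomial factors distinct as germs. -/
theorem dvd_of_coe_dvd {A : Type*} [CommRing A] {I : Ideal A} [IsAdicComplete I A] {G P : A[X]}
    (hG : G.IsDistinguishedAt I) (h : (G : PowerSeries A) ∣ P) : G ∣ P := by
  rw [← Ideal.Quotient.eq_zero_iff_dvd]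
  apply hG.algEquivQuotient.injective
  rw [map_zero]
  exact (Ideal.Quotient.eq_zero_iff_dvd _ _).2 h

end

end AtInfinity

/-! ### Counting the branches of a germ from its parametrizations. -/

namespace AtInfinity

noncomputable section

open Polynomial

variable {K : Type*} [Field K]

/-- The germs of functions at the origin of the plane, as power series in `s = X 0` over the power
series in `z = X 1`. -/
def germEquiv (K : Type*) [Field K] :
    MvPowerSeries (Fin 2) K ≃+* PowerSeries (PowerSeries K) :=
  (MvPowerSeries.renameEquiv K ((finSuccEquiv 1).trans
    (Equiv.optionCongr finOneEquiv))).toRingEquiv.trans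
      (MvPowerSeries.optionEquivLeft Unit K).toRingEquiv

/-- A polynomial in `s = X 0` and `z = X 1`, as a polynomial in `s` over the power series in `z`. -/
def toPoly : MvPolynomial (Fin 2) K →ₐ[K] (PowerSeries K)[X] :=
  MvPolynomial.aeval ![X, C PowerSeries.X]

theorem germEquiv_X_zero : germEquiv K (MvPowerSeries.X 0) = PowerSeries.X := by
  simp [germEquiv]

theorem germEquiv_X_one :
    germEquiv K (MvPowerSeries.X 1) = PowerSeries.C (PowerSeries.X) := by
  have : (finSuccEquiv 1) 1 = some 0 := rfl
  simp [germEquiv, this]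
  rfl

theorem germEquiv_C (c : K) : germEquiv K (MvPowerSeries.C c) = PowerSeries.C (PowerSeries.C c) := by
  simp [germEquiv]
  rfl

theorem germEquiv_coe (F : MvPolynomial (Fin 2) K) :
    germEquiv K (F : MvPowerSeries (Fin 2) K) = (toPoly F : (PowerSeries K)[X]) := by
  induction F using MvPolynomial.induction_on with
  | C c =>
    rw [MvPolynomial.coe_C, germEquiv_C, toPoly, MvPolynomial.aeval_C]
    simp [Polynomial.algebraMap_apply]
  | add F G hF hG => rw [MvPolynomial.coe_add, map_add, hF, hG, map_add, Polynomial.coe_add]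
  | mul_X F i hF =>
    rw [MvPolynomial.coe_mul, map_mul, hF, map_mul, Polynomial.coe_mul, MvPolynomial.coe_X]
    congr 1
    rw [toPoly, MvPolynomial.aeval_X]
    fin_cases i
    · exact germEquiv_X_zero.trans (by simp)
    · exact germEquiv_X_one.trans (by simp)

theorem aeval_toPoly {n : ℕ} [NeZero n] (σ : PowerSeries K) (F : MvPolynomial (Fin 2) K) :
    aeval (Ramified.of n σ) (toPoly F) =
      (MvPolynomial.aeval ![σ, PowerSeries.X ^ n] F : PowerSeries K) := by
  let φ : (PowerSeries K)[X] →+* PowerSeries K :=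
    eval₂RingHom (PowerSeries.expand n (NeZero.ne n) : PowerSeries K →ₐ[K] PowerSeries K).toRingHom σ
  change φ (toPoly F) = _
  have : ∀ c : K, φ (algebraMap K (PowerSeries K)[X] c) = algebraMap K (PowerSeries K) c := by
    intro c
    rw [Polynomial.algebraMap_apply]
    simp only [φ, coe_eval₂RingHom, eval₂_C, PowerSeries.algebraMap_apply, Algebra.algebraMap_self,
      RingHom.id_apply]
    exact PowerSeries.expand_C _ _ _
  rw [toPoly, MvPolynomial.aeval_def, MvPolynomial.hom_eval₂, MvPolynomial.aeval_def]
  congr 1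
  · exact RingHom.ext this
  · funext i
    fin_cases i <;> simp [φ]

/-- The irreducible factors of a germ, up to units. -/
def localBranches (F : MvPolynomial (Fin 2) K) : Set (Associates (MvPowerSeries (Fin 2) K)) :=
  {b | Irreducible b ∧ b ∣ Associates.mk (F : MvPowerSeries (Fin 2) K)}

theorem setOf_irreducible_dvd_of_prime {R : Type*} [CommRing R] [IsDomain R] {G : R}
    (hG : Prime G) :
    {b : Associates R | Irreducible b ∧ b ∣ Associates.mk G} = {Associates.mk G} := by
  have hG' : Irreducible (Associates.mk G) := (Associates.irreducible_mk).2 hG.irreducible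
  ext b
  rw [Set.mem_ofPred_eq, Set.mem_singleton_iff]
  constructor
  · rintro ⟨hb, hd⟩
    exact associated_iff_eq.1 (hb.associated_of_dvd hG' hd)
  · rintro rfl
    exact ⟨hG', dvd_rfl⟩

/-- G divides b or its cofactor. In the first case b is G; in the second, cancelling G leaves b as a
divisor of H. -/
theorem setOf_irreducible_dvd_of_prime_mul {R : Type*} [CommRing R] [IsDomain R] {G H : R}
    (hG : Prime G) (hH : Prime H) :
    {b : Associates R | Irreducible b ∧ b ∣ Associates.mk (G * H)} =
      {Associates.mk G, Associates.mk H} := by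
  have hG' : Irreducible (Associates.mk G) := (Associates.irreducible_mk).2 hG.irreducible
  have hH' : Irreducible (Associates.mk H) := (Associates.irreducible_mk).2 hH.irreducible
  have hG'' : Prime (Associates.mk G) := Associates.prime_mk.2 hG
  ext b
  rw [Set.mem_ofPred_eq, Set.mem_insert_iff, Set.mem_singleton_iff]
  constructor
  · rintro ⟨hb, c, hd⟩
    rw [← Associates.mk_mul_mk] at hd
    rcases hG''.dvd_or_dvd (Dvd.intro _ hd) with h | ⟨c', rfl⟩
    · exact Or.inl (associated_iff_eq.1 (hG'.associated_of_dvd hb h)).symm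
    · right
      rw [mul_left_comm] at hd
      have := mul_left_cancel₀ hG'.ne_zero hd
      exact associated_iff_eq.1 (hb.associated_of_dvd hH' (Dvd.intro _ this.symm))
  · rintro (rfl | rfl)
    · exact ⟨hG', by rw [← Associates.mk_mul_mk]; exact dvd_mul_right _ _⟩
    · exact ⟨hH', by rw [← Associates.mk_mul_mk]; exact dvd_mul_left _ _⟩

theorem exists_prime_of_dvd_toPoly {F : MvPolynomial (Fin 2) K}
    (hF : (toPoly F).IsDistinguishedAt (Ideal.span {PowerSeries.X}))
    {G : (PowerSeries K)[X]} (hG : G.Monic) (hp : Prime G) (h : G ∣ toPoly F) :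
    Prime ((germEquiv K).symm G) :=
  (MulEquiv.prime_iff (germEquiv K).symm.toMulEquiv).2
    (prime_coe_of_isDistinguishedAt (isDistinguishedAt_of_dvd hF hG h) hp)

theorem coe_eq_symm_toPoly (F : MvPolynomial (Fin 2) K) :
    (F : MvPowerSeries (Fin 2) K) = (germEquiv K).symm (toPoly F : (PowerSeries K)[X]) := by
  rw [← germEquiv_coe, RingEquiv.symm_apply_apply]

/-- `(s, z) = (σ(τ), τ ^ n)` is a parametrization of a component of `F = 0`, and `σ` involves
`τ ^ k` with `k` prime to `n`. -/
structure IsParametrization (F : MvPolynomial (Fin 2) K) (n k : ℕ) (σ : PowerSeries K) : Prop where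
  eval_eq_zero : MvPolynomial.aeval ![σ, PowerSeries.X ^ n] F = 0
  coprime : n.Coprime k
  coeff_ne_zero : PowerSeries.coeff k σ ≠ 0

variable {F : MvPolynomial (Fin 2) K} {n k : ℕ} [NeZero n] {σ : PowerSeries K}

namespace IsParametrization

theorem aeval_toPoly_eq_zero (h : IsParametrization F n k σ) :
    aeval (Ramified.of n σ) (toPoly F) = 0 := by
  rw [aeval_toPoly, h.eval_eq_zero]
  rfl

theorem isIntegral (h : IsParametrization F n k σ) (hF : (toPoly F).Monic) :
    IsIntegral (PowerSeries K) (Ramified.of n σ) :=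
  ⟨_, hF, h.aeval_toPoly_eq_zero⟩

theorem minpoly_dvd (h : IsParametrization F n k σ) (hF : (toPoly F).Monic) :
    minpoly (PowerSeries K) (Ramified.of n σ) ∣ toPoly F :=
  minpoly.isIntegrallyClosed_dvd (h.isIntegral hF) h.aeval_toPoly_eq_zero

/-- The n conjugates of σ are distinct roots of its minimal polynomial. -/
theorem le_natDegree_minpoly [IsAlgClosed K] [CharZero K] (h : IsParametrization F n k σ)
    (hF : (toPoly F).Monic) :
    n ≤ (minpoly (PowerSeries K) (Ramified.of n σ)).natDegree :=
  (card_conjugates h.coprime h.coeff_ne_zero).ge.trans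
    (card_le_natDegree (minpoly.monic (h.isIntegral hF))
      fun _ hs => aeval_of_mem_conjugates (minpoly.aeval _ _) hs)

end IsParametrization

instance : IsDomain (MvPowerSeries (Fin 2) K) := NoZeroDivisors.to_isDomain _

/-- A germ of degree `n` with a parametrization of degree `n` is irreducible. -/
theorem encard_localBranches_eq_one [IsAlgClosed K] [CharZero K]
    (hF : (toPoly F).IsDistinguishedAt (Ideal.span {PowerSeries.X}))
    (hdeg : (toPoly F).natDegree = n) (h : IsParametrization F n k σ) :
    (localBranches F).encard = 1 := by
  have hm := hF.monic
  have hG := minpoly.monic (h.isIntegral hm)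
  have heq : toPoly F = minpoly (PowerSeries K) (Ramified.of n σ) :=
    (eq_of_monic_of_dvd_of_natDegree_le hG hm (h.minpoly_dvd hm)
      (hdeg.le.trans (h.le_natDegree_minpoly hm)))
  rw [localBranches, coe_eq_symm_toPoly, setOf_irreducible_dvd_of_prime, Set.encard_singleton]
  rw [heq]
  exact exists_prime_of_dvd_toPoly hF hG (minpoly.prime_of_isIntegrallyClosed (h.isIntegral hm))
    (h.minpoly_dvd hm)

/-- A germ of degree `n + n'` with parametrizations of degrees `n` and `n'` that have different
minimal polynomials has exactly two branches. -/
theorem encard_localBranches_eq_two [IsAlgClosed K] [CharZero K]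
    (hF : (toPoly F).IsDistinguishedAt (Ideal.span {PowerSeries.X}))
    {n' k' : ℕ} [NeZero n'] {σ' : PowerSeries K}
    (hdeg : (toPoly F).natDegree = n + n') (h : IsParametrization F n k σ)
    (h' : IsParametrization F n' k' σ')
    (hne : minpoly (PowerSeries K) (Ramified.of n σ) ≠
      minpoly (PowerSeries K) (Ramified.of n' σ')) :
    (localBranches F).encard = 2 := by
  have hm := hF.monic
  have hG := minpoly.monic (h.isIntegral hm)
  have hG' := minpoly.monic (h'.isIntegral hm)
  have hp := minpoly.prime_of_isIntegrallyClosed (h.isIntegral hm)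
  have hp' := minpoly.prime_of_isIntegrallyClosed (h'.isIntegral hm)
  set G := minpoly (PowerSeries K) (Ramified.of n σ)
  set G' := minpoly (PowerSeries K) (Ramified.of n' σ')
  -- G and G' are distinct monic primes dividing F, so their product does too; since deg F = n + n',
  -- the degrees leave no further factor.
  have hGG' : G * G' ∣ toPoly F := by
    obtain ⟨Q, hQ⟩ := h.minpoly_dvd hm
    have h1 := h'.minpoly_dvd hm
    rw [hQ] at h1 ⊢
    refine mul_dvd_mul_left _ ((hp'.dvd_or_dvd h1).resolve_left fun h2 => hne ?_)
    exact eq_of_monic_of_associated hG hG'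
      (hp'.irreducible.associated_of_dvd hp.irreducible h2).symm
  have heq : toPoly F = G * G' := by
    refine eq_of_monic_of_dvd_of_natDegree_le (hG.mul hG') hm hGG' ?_
    rw [hdeg, hG.natDegree_mul hG']
    exact add_le_add (h.le_natDegree_minpoly hm) (h'.le_natDegree_minpoly hm)
  have hq := exists_prime_of_dvd_toPoly hF hG hp (h.minpoly_dvd hm)
  have hq' := exists_prime_of_dvd_toPoly hF hG' hp' (h'.minpoly_dvd hm)
  have hd := isDistinguishedAt_of_dvd hF hG (h.minpoly_dvd hm)
  rw [localBranches, coe_eq_symm_toPoly, heq, Polynomial.coe_mul, map_mul,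
    setOf_irreducible_dvd_of_prime_mul hq hq', Set.encard_pair]
  intro hass
  have h1 := (Associates.mk_eq_mk_iff_associated.1 hass).dvd
  rw [map_dvd_iff] at h1
  exact hne (eq_of_monic_of_associated hG hG'
    (hp.irreducible.associated_of_dvd hp'.irreducible (dvd_of_coe_dvd hd h1)))

end

end AtInfinity

/-! ### The local equations of the fibres of p at infinity. -/

namespace AtInfinity

noncomputable section

open MvPolynomial

variable {K : Type*} [Field K]

/-- `germ f a`, as a linear function of `f` when the degree `D` of `f` is prescribed. -/
def germOfDegree (D : ℕ) (a : Option K) : MvPolynomial (Fin 2) K →ₗ[K] MvPolynomial (Fin 2) K :=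
  (basisMonomials (Fin 2) K).constr K fun m =>
    a.elim (X 0 ^ (m 0)) (fun c => (X 0 + C c) ^ (m 1)) * X 1 ^ (D - (m 0 + m 1))

theorem germ_eq_germOfDegree (f : MvPolynomial (Fin 2) K) (a : Option K) :
    germ f a = germOfDegree f.totalDegree a f := by
  rw [germOfDegree, Module.Basis.constr_apply]
  cases a <;> simp only [germ, smul_eq_C_mul, mul_assoc] <;> rfl

theorem germOfDegree_term (D : ℕ) (a : Option K) (c : K) (i j : ℕ) :
    germOfDegree D a (C c * X 0 ^ i * X 1 ^ j) =
      C c * (a.elim (X 0 ^ i) (fun c => (X 0 + C c) ^ j) * X 1 ^ (D - (i + j))) := by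
  have h : (C c * X 0 ^ i * X 1 ^ j : MvPolynomial (Fin 2) K) =
      c • basisMonomials (Fin 2) K (Finsupp.single 0 i + Finsupp.single 1 j) := by
    rw [coe_basisMonomials, smul_eq_C_mul, X_pow_eq_monomial, X_pow_eq_monomial, mul_assoc,
      monomial_mul, one_mul]
  rw [h, map_smul, germOfDegree, Module.Basis.constr_basis, smul_eq_C_mul]
  simp

/-- Every term is in the shape C c * X 0 ^ i * X 1 ^ j, to which `germOfDegree_term` and
`coeff_term` apply. -/
theorem p_eq_sum_terms : p K =
    C 1 * X 0 ^ 6 * X 1 ^ 5 + C (-5) * X 0 ^ 5 * X 1 ^ 4 + C 10 * X 0 ^ 4 * X 1 ^ 3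
      + C (-2) * X 0 ^ 3 * X 1 ^ 3 + C (-10) * X 0 ^ 3 * X 1 ^ 2 + C 5 * X 0 ^ 2 * X 1 ^ 2
      + C 5 * X 0 ^ 2 * X 1 ^ 1 + C (-(15 / 4)) * X 0 ^ 1 * X 1 ^ 1 + C (-1) * X 0 ^ 1 * X 1 ^ 0
      + C 1 * X 0 ^ 0 * X 1 ^ 1 := by
  simp only [p, C_neg, C_1, map_ofNat]
  ring

theorem totalDegree_term_le (c : K) (i j : ℕ) :
    (C c * X 0 ^ i * X 1 ^ j : MvPolynomial (Fin 2) K).totalDegree ≤ i + j := by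
  rw [mul_assoc, X_pow_eq_monomial, X_pow_eq_monomial, monomial_mul, C_mul_monomial]
  refine (totalDegree_monomial_le _ _).trans ?_
  rw [Finsupp.sum_add_index' (by simp) (by simp)]
  simp

theorem coeff_term (c : K) (i j i' j' : ℕ) :
    coeff (Finsupp.single 0 i' + Finsupp.single 1 j')
      (C c * X 0 ^ i * X 1 ^ j : MvPolynomial (Fin 2) K) = if i = i' ∧ j = j' then c else 0 := by
  rw [mul_assoc, X_pow_eq_monomial, X_pow_eq_monomial, monomial_mul, C_mul_monomial, coeff_monomial]
  congr 1
  · refine propext ⟨fun h => ⟨?_, ?_⟩, ?_⟩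
    · simpa using DFunLike.congr_fun h 0
    · simpa using DFunLike.congr_fun h 1
    · rintro ⟨rfl, rfl⟩
      rfl
  · simp

theorem totalDegree_p_sub_C (t : K) : (p K - C t).totalDegree = 11 := by
  have hC : (C t : MvPolynomial (Fin 2) K) = C t * X 0 ^ 0 * X 1 ^ 0 := by simp
  apply le_antisymm
  · have hadd : ∀ {f : MvPolynomial (Fin 2) K} {c : K} {i j : ℕ}, f.totalDegree ≤ 11 →
        i + j ≤ 11 → (f + C c * X 0 ^ i * X 1 ^ j).totalDegree ≤ 11 := fun hf hij =>
      (totalDegree_add _ _).trans (max_le hf ((totalDegree_term_le _ _ _).trans hij))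
    rw [p_eq_sum_terms, hC]
    refine (totalDegree_sub _ _).trans (max_le ?_ ((totalDegree_term_le _ _ _).trans (by norm_num)))
    iterate 9 refine hadd ?_ (by norm_num)
    exact totalDegree_term_le _ _ _
  · have h : coeff (Finsupp.single 0 6 + Finsupp.single 1 5) (p K - C t) = 1 := by
      rw [p_eq_sum_terms, hC]
      simp only [coeff_sub, coeff_add, coeff_term]
      norm_num
    have h' := le_totalDegree (p := p K - C t) (s := Finsupp.single 0 6 + Finsupp.single 1 5)
      (by rw [mem_support_iff, h]; exact one_ne_zero)
    rw [Finsupp.sum_add_index' (by simp) (by simp)] at h'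
    simpa using h'

theorem totalDegree_p : (p K).totalDegree = 11 := by
  simpa using totalDegree_p_sub_C (0 : K)

/-- p - t has degree 11 for every t, so both germs use the same D, and `germOfDegree` is linear with
t ↦ t z^11. -/
theorem germ_p_sub_C (a : Option K) (t : K) : germ (p K - C t) a = fibreGerm (p K) a t := by
  have hC : (C t : MvPolynomial (Fin 2) K) = C t * X 0 ^ 0 * X 1 ^ 0 := by simp
  rw [germ_eq_germOfDegree, totalDegree_p_sub_C, fibreGerm, germ_eq_germOfDegree, poleGerm,
    totalDegree_p, map_sub]
  congr 1
  rw [hC, germOfDegree_term]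
  cases a <;> simp

theorem germ_p_none : germ (p K) none =
    X 0 ^ 6 - 5 * X 0 ^ 5 * X 1 ^ 2 + 10 * X 0 ^ 4 * X 1 ^ 4 - 2 * X 0 ^ 3 * X 1 ^ 5
      - 10 * X 0 ^ 3 * X 1 ^ 6 + 5 * X 0 ^ 2 * X 1 ^ 7 + 5 * X 0 ^ 2 * X 1 ^ 8
      - C (15 / 4) * X 0 * X 1 ^ 9 - X 0 * X 1 ^ 10 + X 1 ^ 10 := by
  rw [germ_eq_germOfDegree, totalDegree_p, p_eq_sum_terms]
  simp only [map_add, germOfDegree_term, Option.elim]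
  simp only [C_neg, C_1, map_ofNat]
  ring

theorem germ_p_some (c : K) : germ (p K) (some c) =
    (X 0 + C c) ^ 5 - 5 * (X 0 + C c) ^ 4 * X 1 ^ 2 + 10 * (X 0 + C c) ^ 3 * X 1 ^ 4
      - 2 * (X 0 + C c) ^ 3 * X 1 ^ 5 - 10 * (X 0 + C c) ^ 2 * X 1 ^ 6
      + 5 * (X 0 + C c) ^ 2 * X 1 ^ 7 + 5 * (X 0 + C c) * X 1 ^ 8
      - C (15 / 4) * (X 0 + C c) * X 1 ^ 9 - X 1 ^ 10 + (X 0 + C c) * X 1 ^ 10 := by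
  rw [germ_eq_germOfDegree, totalDegree_p, p_eq_sum_terms]
  simp only [map_add, germOfDegree_term, Option.elim]
  simp only [C_neg, C_1, map_ofNat]
  ring

theorem germ_p_zero : germ (p K) (some 0) =
    X 0 ^ 5 - 5 * X 0 ^ 4 * X 1 ^ 2 + 10 * X 0 ^ 3 * X 1 ^ 4 - 2 * X 0 ^ 3 * X 1 ^ 5
      - 10 * X 0 ^ 2 * X 1 ^ 6 + 5 * X 0 ^ 2 * X 1 ^ 7 + 5 * X 0 * X 1 ^ 8
      - C (15 / 4) * X 0 * X 1 ^ 9 - X 1 ^ 10 + X 0 * X 1 ^ 10 := by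
  simp [germ_p_some]

theorem poleGerm_p : poleGerm (p K) = X 1 ^ 11 := by
  rw [poleGerm, totalDegree_p]

end

end AtInfinity

/-! ### Puiseux parametrizations of the fibres at infinity. -/

namespace AtInfinity

noncomputable section

variable {K : Type*} [Field K]

open Polynomial in
theorem exists_eval_eq_zero (Φ : (PowerSeries K)[X]) (c : K)
    (h : PowerSeries.constantCoeff (Φ.eval (PowerSeries.C c)) = 0)
    (h' : PowerSeries.constantCoeff (Φ.derivative.eval (PowerSeries.C c)) ≠ 0) :
    ∃ v, Φ.eval v = 0 ∧ PowerSeries.constantCoeff v = c := by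
  have hu : IsUnit (Φ.derivative.eval (PowerSeries.C c)) :=
    PowerSeries.isUnit_iff_constantCoeff.2 (isUnit_iff_ne_zero.2 h')
  obtain ⟨v, hv, hvc⟩ := IsAdicComplete.exists_isRoot_of_isUnit_derivative
    (Ideal.span {(PowerSeries.X : PowerSeries K)}) Φ (PowerSeries.C c)
    (by rwa [Ideal.mem_span_singleton, PowerSeries.X_dvd_iff]) (hu.map _)
  refine ⟨v, hv, ?_⟩
  rw [Ideal.mem_span_singleton, PowerSeries.X_dvd_iff, map_sub, PowerSeries.constantCoeff_C] at hvc
  exact sub_eq_zero.1 hvc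

open Polynomial in
theorem isDistinguishedAt_X_pow_add {P R : (PowerSeries K)[X]} {N : ℕ}
    (h : P = X ^ N + C PowerSeries.X * R) (hR : R.degree < N) :
    P.IsDistinguishedAt (Ideal.span {PowerSeries.X}) ∧ P.natDegree = N := by
  have hR' : (C PowerSeries.X * R).degree < (N : WithBot ℕ) := by
    rwa [degree_C_mul PowerSeries.X_ne_zero]
  have hm : P.Monic := h ▸ monic_X_pow_add hR'
  have hN : P.natDegree = N := by
    rw [h]
    refine natDegree_eq_of_degree_eq_some ?_
    rw [degree_add_eq_left_of_degree_lt] <;> rw [degree_X_pow]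
    exact hR'
  refine ⟨⟨⟨fun {i} hi => ?_⟩, hm⟩, hN⟩
  rw [hN] at hi
  rw [h, coeff_add, coeff_X_pow, if_neg hi.ne, zero_add, coeff_C_mul]
  exact Ideal.mul_mem_right _ _ (Ideal.mem_span_singleton_self _)

theorem toPoly_X_zero : toPoly (MvPolynomial.X 0 : MvPolynomial (Fin 2) K) = Polynomial.X := by
  simp [toPoly]

theorem toPoly_X_one :
    toPoly (MvPolynomial.X 1 : MvPolynomial (Fin 2) K) = Polynomial.C PowerSeries.X := by
  simp [toPoly]

theorem toPoly_C (c : K) :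
    toPoly (MvPolynomial.C c) = Polynomial.C (PowerSeries.C c) := by
  rw [toPoly, MvPolynomial.aeval_C, Polynomial.algebraMap_apply]
  rfl

open Polynomial in
theorem isDistinguishedAt_toPoly_none (t : K) :
    (toPoly (fibreGerm (p K) none t)).IsDistinguishedAt (Ideal.span {PowerSeries.X}) ∧
      (toPoly (fibreGerm (p K) none t)).natDegree = 6 := by
  refine isDistinguishedAt_X_pow_add (R := C (-5 * PowerSeries.X) * X ^ 5
    + C (10 * PowerSeries.X ^ 3) * X ^ 4 + C (-2 * PowerSeries.X ^ 4 - 10 * PowerSeries.X ^ 5) * X ^ 3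
    + C (5 * PowerSeries.X ^ 6 + 5 * PowerSeries.X ^ 7) * X ^ 2
    + C (-(PowerSeries.C (15 / 4) * PowerSeries.X ^ 8) - PowerSeries.X ^ 9) * X
    + C (PowerSeries.X ^ 9 - PowerSeries.C t * PowerSeries.X ^ 10)) ?_ ?_
  · rw [fibreGerm, germ_p_none, poleGerm_p]
    simp only [map_add, map_sub, map_mul, map_pow, map_neg, map_ofNat, toPoly_X_zero, toPoly_X_one,
      toPoly_C]
    ring
  · refine lt_of_le_of_lt (b := ((5 : ℕ) : WithBot ℕ)) ?_ (by norm_num)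
    compute_degree
    exact le_rfl

open Polynomial in
theorem isDistinguishedAt_toPoly_some_zero (t : K) :
    (toPoly (fibreGerm (p K) (some 0) t)).IsDistinguishedAt (Ideal.span {PowerSeries.X}) ∧
      (toPoly (fibreGerm (p K) (some 0) t)).natDegree = 5 := by
  refine isDistinguishedAt_X_pow_add (R := C (-5 * PowerSeries.X) * X ^ 4
    + C (10 * PowerSeries.X ^ 3 - 2 * PowerSeries.X ^ 4) * X ^ 3
    + C (-10 * PowerSeries.X ^ 5 + 5 * PowerSeries.X ^ 6) * X ^ 2
    + C (5 * PowerSeries.X ^ 7 - PowerSeries.C (15 / 4) * PowerSeries.X ^ 8 + PowerSeries.X ^ 9) * X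
    + C (-PowerSeries.X ^ 9 - PowerSeries.C t * PowerSeries.X ^ 10)) ?_ ?_
  · rw [fibreGerm, germ_p_zero, poleGerm_p]
    simp only [map_add, map_sub, map_mul, map_pow, map_neg, map_ofNat, toPoly_X_zero, toPoly_X_one,
      toPoly_C]
    ring
  · refine lt_of_le_of_lt (b := ((4 : ℕ) : WithBot ℕ)) ?_ (by norm_num)
    compute_degree
    exact le_rfl

/-- The equation of the fibre at `[0 : 1 : 0]`, at `s = S`, `z = Z`. -/
theorem aeval_fibreGerm_none (S Z : PowerSeries K) (t : K) :
    MvPolynomial.aeval ![S, Z] (fibreGerm (p K) none t) =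
      S ^ 6 - 5 * S ^ 5 * Z ^ 2 + 10 * S ^ 4 * Z ^ 4 - 2 * S ^ 3 * Z ^ 5 - 10 * S ^ 3 * Z ^ 6
        + 5 * S ^ 2 * Z ^ 7 + 5 * S ^ 2 * Z ^ 8 - PowerSeries.C (15 / 4) * S * Z ^ 9 - S * Z ^ 10
        + Z ^ 10 - PowerSeries.C t * Z ^ 11 := by
  rw [fibreGerm, germ_p_none, poleGerm_p]
  simp

theorem aeval_fibreGerm_some_zero (S Z : PowerSeries K) (t : K) :
    MvPolynomial.aeval ![S, Z] (fibreGerm (p K) (some 0) t) =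
      S ^ 5 - 5 * S ^ 4 * Z ^ 2 + 10 * S ^ 3 * Z ^ 4 - 2 * S ^ 3 * Z ^ 5 - 10 * S ^ 2 * Z ^ 6
        + 5 * S ^ 2 * Z ^ 7 + 5 * S * Z ^ 8 - PowerSeries.C (15 / 4) * S * Z ^ 9 - Z ^ 10
        + S * Z ^ 10 - PowerSeries.C t * Z ^ 11 := by
  rw [fibreGerm, germ_p_zero, poleGerm_p]
  simp

section Parametrizations

variable [CharZero K]

open PowerSeries in
theorem exists_isParametrization_some_zero {t c : K} (hc : c ^ 5 = 3 / 4 + t) (hc0 : c ≠ 0) :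
    ∃ σ, IsParametrization (fibreGerm (p K) (some 0) t) 5 11 σ := by
  -- Here `X` is τ, with z = τ^5, and `Polynomial.X` is the unknown v. For s = z^2 u, u = 1 + τv,
  -- the terms of order z^10 sum to z^10 (u-1)^5 = z^11 v^5. Φ is the local equation divided by z^11
  -- = τ^55, and at τ = 0 it is v^5 - 3/4 - t.
  let Φ : Polynomial (PowerSeries K) := Polynomial.X ^ 5
    - 2 * (1 + Polynomial.C X * Polynomial.X) ^ 3 + 5 * (1 + Polynomial.C X * Polynomial.X) ^ 2
    - Polynomial.C (C (15 / 4)) * (1 + Polynomial.C X * Polynomial.X) - Polynomial.C (C t)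
    + Polynomial.C (X ^ 5) * (1 + Polynomial.C X * Polynomial.X)
  obtain ⟨v, hv, hvc⟩ := exists_eval_eq_zero Φ c
    (by simp [map_ofNat constantCoeff, Φ, hc]; ring)
    (by simp [map_ofNat constantCoeff, Φ, Polynomial.derivative_pow, hc0])
  simp only [Φ, Polynomial.eval_add, Polynomial.eval_sub, Polynomial.eval_mul, Polynomial.eval_pow,
    Polynomial.eval_X, Polynomial.eval_C, Polynomial.eval_one, Polynomial.eval_ofNat] at hv
  refine ⟨X ^ 10 + X ^ 11 * v, ?_, by norm_num, ?_⟩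
  · rw [aeval_fibreGerm_some_zero]
    linear_combination X ^ 55 * hv
  · rw [map_add, coeff_X_pow, coeff_X_pow_mul', if_neg (by norm_num), if_pos le_rfl]
    simpa [hvc] using hc0

open PowerSeries in
theorem exists_isParametrization_some_zero_of_pow_four {c : K} (hc : c ^ 4 = -(1 / 4)) :
    ∃ σ, IsParametrization (fibreGerm (p K) (some 0) (-3 / 4)) 4 9 σ := by
  have hc0 : c ≠ 0 := by
    rintro rfl
    norm_num at hc
  -- With s = z^2(1+h) and t = -3/4 the equation is h^5 + z(h/4 - h^2 - 2h^3) + z^2(1+h) = 0. Its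
  -- Newton polygon has the edges h^4 = -z/4 and h = -4z. This is the first one: z = τ^4, h = τv,
  -- division by τ^5; the coefficient 4 - 15/4 is 1/4.
  let Φ : Polynomial (PowerSeries K) := Polynomial.X ^ 5
    + Polynomial.C (4 - C (15 / 4)) * Polynomial.X - Polynomial.C X * Polynomial.X ^ 2
    - 2 * Polynomial.C X ^ 2 * Polynomial.X ^ 3
    + Polynomial.C X ^ 3 * (1 + Polynomial.C X * Polynomial.X)
  obtain ⟨v, hv, hvc⟩ := exists_eval_eq_zero Φ c
    (by simp [map_ofNat constantCoeff, Φ]; linear_combination c * hc)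
    (by simp [map_ofNat constantCoeff, Φ, Polynomial.derivative_pow, hc]; norm_num)
  simp only [Φ, Polynomial.eval_add, Polynomial.eval_sub, Polynomial.eval_mul, Polynomial.eval_pow,
    Polynomial.eval_X, Polynomial.eval_C, Polynomial.eval_one, Polynomial.eval_ofNat] at hv
  have ht : C (-3 / 4 : K) = 3 - C (15 / 4) := by
    rw [← map_ofNat C 3, ← map_sub]
    norm_num
  refine ⟨X ^ 8 + X ^ 9 * v, ?_, by norm_num, ?_⟩
  · rw [aeval_fibreGerm_some_zero, ht]
    linear_combination X ^ 45 * hv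
  · rw [map_add, coeff_X_pow, coeff_X_pow_mul', if_neg (by norm_num), if_pos le_rfl]
    simpa [hvc] using hc0

open PowerSeries in
theorem exists_isParametrization_some_zero_smooth :
    ∃ σ, IsParametrization (fibreGerm (p K) (some 0) (-3 / 4)) 1 2 σ := by
  -- The edge h = -4z of the same Newton polygon: h = zv with v(0) = -4, after division by z^2.
  let Φ : Polynomial (PowerSeries K) := Polynomial.C X ^ 3 * Polynomial.X ^ 5
    + Polynomial.C (4 - C (15 / 4)) * Polynomial.X - Polynomial.C X * Polynomial.X ^ 2
    - 2 * Polynomial.C X ^ 2 * Polynomial.X ^ 3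
    + (1 + Polynomial.C X * Polynomial.X)
  obtain ⟨v, hv, hvc⟩ := exists_eval_eq_zero Φ (-4)
    (by simp [map_ofNat constantCoeff, Φ]; norm_num)
    (by simp [map_ofNat constantCoeff, Φ, Polynomial.derivative_pow]; norm_num)
  simp only [Φ, Polynomial.eval_add, Polynomial.eval_sub, Polynomial.eval_mul, Polynomial.eval_pow,
    Polynomial.eval_X, Polynomial.eval_C, Polynomial.eval_one, Polynomial.eval_ofNat] at hv
  have ht : C (-3 / 4 : K) = 3 - C (15 / 4) := by
    rw [← map_ofNat C 3, ← map_sub]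
    norm_num
  refine ⟨X ^ 2 + X ^ 3 * v, ?_, by norm_num, ?_⟩
  · rw [aeval_fibreGerm_some_zero, ht]
    linear_combination X ^ 12 * hv
  · rw [map_add, coeff_X_pow, coeff_X_pow_mul', if_pos rfl, if_neg (by norm_num)]
    simp

open PowerSeries in
theorem exists_isParametrization_none {t c : K} (hc : 9 * c ^ 2 = 5 / 8 + t) (hc0 : c ≠ 0) :
    ∃ σ, IsParametrization (fibreGerm (p K) none t) 6 13 σ := by
  let B : PowerSeries K := C (5 / 6)
  let b : Polynomial (PowerSeries K) := Polynomial.C B + Polynomial.C X * Polynomial.X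
  let A : Polynomial (PowerSeries K) := 1 + Polynomial.C X ^ 2 * b
  let Φ : Polynomial (PowerSeries K) :=
    (3 * Polynomial.X + Polynomial.C X * (3 * b ^ 2 - 6 * Polynomial.C B * b)
      + Polynomial.C X ^ 3 * (b ^ 3 - 3 * Polynomial.C B * b ^ 2)) ^ 2
    + Polynomial.C (C (15 / 4)) * A * b * (1 + A + A ^ 2)
    - 10 * A ^ 3 - Polynomial.C (C t) + 5 * Polynomial.C X ^ 2 * A ^ 2 - Polynomial.C X ^ 4 * A
  obtain ⟨v, hv, hvc⟩ := exists_eval_eq_zero Φ c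
    (by simp [map_ofNat constantCoeff, Φ, A, b, B]; linear_combination hc)
    (by simp [map_ofNat constantCoeff, Φ, A, b, B, Polynomial.derivative_pow, hc0])
  simp only [Φ, A, b, Polynomial.eval_add, Polynomial.eval_sub, Polynomial.eval_mul,
    Polynomial.eval_pow, Polynomial.eval_X, Polynomial.eval_C, Polynomial.eval_one,
    Polynomial.eval_ofNat] at hv
  have hB : 6 * B = 5 := by
    rw [← map_ofNat C 6, ← map_mul, ← map_ofNat C 5]
    norm_num
  have hκ : C (15 / 4 : K) = 10 - 9 * B ^ 2 := by
    rw [← map_ofNat C 9, ← map_pow, ← map_mul, ← map_ofNat C 10, ← map_sub]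
    norm_num
  refine ⟨X ^ 10 + B * X ^ 12 + X ^ 13 * v, ?_, by norm_num, ?_⟩
  · rw [aeval_fibreGerm_none]
    linear_combination X ^ 66 * hv
      + X ^ 64 * (1 + X ^ 2 * (B + X * v)) ^ 2 * (B + X * v)
        * (3 + 3 * (X ^ 2 * (B + X * v)) + (X ^ 2 * (B + X * v)) ^ 2) * hB
      - X ^ 64 * (1 + X ^ 2 * (B + X * v)) ^ 4 * hκ
  · simp [B, coeff_X_pow, coeff_X_pow_mul', hvc, hc0]

open PowerSeries in
theorem exists_isParametrization_none_of_eq {l : K} (hl : l ^ 2 + 15 / 4 * l + 55 / 16 = 0)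
    (hl' : 2 * l + 15 / 4 ≠ 0) :
    ∃ σ, IsParametrization (fibreGerm (p K) none (-5 / 8)) 3 5 σ ∧
      coeff 5 σ = 1 ∧ coeff 7 σ = (l + 25 / 12) / 3 := by
  -- For t = -5/8 the term c z^(1/2) disappears and z = τ^3 suffices. Φ is the equation divided by
  -- τ^34; at τ = 0, with l = 3v - 25/12, it is l^2 + (15/4)l + 55/16, and `hl'` says that the root
  -- l is simple.
  let B : PowerSeries K := C (5 / 6)
  let b : Polynomial (PowerSeries K) := Polynomial.C B + Polynomial.C X * Polynomial.X
  let A : Polynomial (PowerSeries K) := 1 + Polynomial.C X * b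
  let Φ : Polynomial (PowerSeries K) :=
    (3 * Polynomial.X + 3 * b ^ 2 - 6 * Polynomial.C B * b
      + Polynomial.C X * (b ^ 3 - 3 * Polynomial.C B * b ^ 2)) ^ 2
    + Polynomial.C (C (15 / 4)) * (3 * Polynomial.X + 6 * b ^ 2 + 4 * Polynomial.C X * b ^ 3
      + Polynomial.C X ^ 2 * b ^ 4) - 30 * b - 30 * Polynomial.C X * b ^ 2
    - 10 * Polynomial.C X ^ 2 * b ^ 3 + 5 * A ^ 2 - Polynomial.C X * A
  obtain ⟨v, hv, hvc⟩ := exists_eval_eq_zero Φ ((l + 25 / 12) / 3)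
    (by simp [map_ofNat constantCoeff, Φ, A, b, B]; linear_combination hl)
    (by
      simp [map_ofNat constantCoeff, Φ, A, b, B, Polynomial.derivative_pow]
      intro h
      apply hl'
      linear_combination h / 3)
  simp only [Φ, A, b, Polynomial.eval_add, Polynomial.eval_sub, Polynomial.eval_mul,
    Polynomial.eval_pow, Polynomial.eval_X, Polynomial.eval_C, Polynomial.eval_one,
    Polynomial.eval_ofNat] at hv
  have hB : 6 * B = 5 := by
    rw [← map_ofNat C 6, ← map_mul, ← map_ofNat C 5]
    norm_num
  have hκ : C (15 / 4 : K) = 10 - 9 * B ^ 2 := by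
    rw [← map_ofNat C 9, ← map_pow, ← map_mul, ← map_ofNat C 10, ← map_sub]
    norm_num
  have ht : C (-5 / 8 : K) = 3 * C (15 / 4) * B - 10 := by
    rw [← map_ofNat C 3, ← map_mul, ← map_mul, ← map_ofNat C 10, ← map_sub]
    norm_num
  have h5 : coeff 5 (X ^ 5 + B * X ^ 6 + X ^ 7 * v) = 1 := by
    simp [B, coeff_X_pow, coeff_X_pow_mul']
  refine ⟨X ^ 5 + B * X ^ 6 + X ^ 7 * v, ⟨?_, by norm_num, ?_⟩, h5, ?_⟩
  · rw [aeval_fibreGerm_none]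
    linear_combination X ^ 34 * hv
      + X ^ 32 * (1 + X * (B + X * v)) ^ 2 * (B + X * v)
        * (3 + 3 * (X * (B + X * v)) + (X * (B + X * v)) ^ 2) * hB
      - X ^ 32 * (1 + X * (B + X * v)) ^ 4 * hκ - X ^ 33 * ht
  · rw [h5]
    exact one_ne_zero
  · simp [B, coeff_X_pow, coeff_X_pow_mul', hvc]

end Parametrizations

end

end AtInfinity

/-! ### The number of branches of each fibre at infinity. -/

namespace AtInfinity

noncomputable section

variable {K : Type*} [Field K]

theorem encard_localBranches_of_isUnit {F : MvPolynomial (Fin 2) K}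
    (h : MvPolynomial.constantCoeff F ≠ 0) : localBranches F = ∅ := by
  have hu : IsUnit (F : MvPowerSeries (Fin 2) K) := by
    rw [MvPowerSeries.isUnit_iff_constantCoeff, isUnit_iff_ne_zero,
      ← MvPowerSeries.coeff_zero_eq_constantCoeff_apply, MvPolynomial.coeff_coe]
    exact h
  refine Set.eq_empty_of_forall_notMem fun b hb => hb.1.not_isUnit ?_
  exact isUnit_of_dvd_unit hb.2 (Associates.isUnit_mk.2 hu)

theorem constantCoeff_fibreGerm_some (c t : K) :
    MvPolynomial.constantCoeff (fibreGerm (p K) (some c) t) = c ^ 5 := by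
  rw [fibreGerm, germ_p_some, poleGerm_p]
  simp

/-- At [1:c:0] with c ≠ 0 the local equation has constant term c^5, so it is a unit and has no
branches. -/
theorem branchesAtInfinity_p_sub_C (t : K) :
    branchesAtInfinity (p K - MvPolynomial.C t) =
      (Prod.mk none) '' localBranches (fibreGerm (p K) none t) ∪
        (Prod.mk (some 0)) '' localBranches (fibreGerm (p K) (some 0) t) := by
  ext ⟨a, b⟩
  rw [branchesAtInfinity, Set.mem_ofPred_eq, germ_p_sub_C]
  change b ∈ localBranches (fibreGerm (p K) a t) ↔ _
  simp only [Set.mem_union, Set.mem_image, Prod.mk.injEq]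
  constructor
  · intro hb
    rcases a with _ | c
    · exact Or.inl ⟨b, hb, rfl, rfl⟩
    · rcases eq_or_ne c 0 with rfl | hc
      · exact Or.inr ⟨b, hb, rfl, rfl⟩
      · rw [encard_localBranches_of_isUnit] at hb
        · exact hb.elim
        · rw [constantCoeff_fibreGerm_some]
          exact pow_ne_zero _ hc
  · rintro (⟨b, hb, rfl, rfl⟩ | ⟨b, hb, rfl, rfl⟩) <;> exact hb

theorem encard_branchesAtInfinity_p_sub_C (t : K) :
    (branchesAtInfinity (p K - MvPolynomial.C t)).encard =
      (localBranches (fibreGerm (p K) none t)).encard +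
        (localBranches (fibreGerm (p K) (some 0) t)).encard := by
  rw [branchesAtInfinity_p_sub_C, Set.encard_union_eq,
    (Prod.mk_right_injective _).encard_image, (Prod.mk_right_injective _).encard_image]
  rw [Set.disjoint_left]
  rintro _ ⟨b, -, rfl⟩ ⟨c, -, h⟩
  simp at h

variable [IsAlgClosed K] [CharZero K]

theorem encard_localBranches_none {t : K} (ht : t ≠ -5 / 8) :
    (localBranches (fibreGerm (p K) none t)).encard = 1 := by
  obtain ⟨c, hc⟩ := IsAlgClosed.exists_pow_nat_eq ((5 / 8 + t) / 9) (zero_lt_two)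
  obtain ⟨σ, hσ⟩ := exists_isParametrization_none (t := t) (c := c) (by rw [hc]; ring) (by
    rintro rfl
    apply ht
    linear_combination -9 * hc)
  obtain ⟨h1, h2⟩ := isDistinguishedAt_toPoly_none t
  exact encard_localBranches_eq_one h1 h2 hσ

theorem encard_localBranches_some_zero {t : K} (ht : t ≠ -3 / 4) :
    (localBranches (fibreGerm (p K) (some 0) t)).encard = 1 := by
  obtain ⟨c, hc⟩ := IsAlgClosed.exists_pow_nat_eq (3 / 4 + t) (show 0 < 5 by norm_num)
  obtain ⟨σ, hσ⟩ := exists_isParametrization_some_zero hc (by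
    rintro rfl
    apply ht
    linear_combination -hc)
  obtain ⟨h1, h2⟩ := isDistinguishedAt_toPoly_some_zero t
  exact encard_localBranches_eq_one h1 h2 hσ

theorem encard_localBranches_some_zero_critical :
    (localBranches (fibreGerm (p K) (some 0) (-3 / 4))).encard = 2 := by
  obtain ⟨c, hc⟩ := IsAlgClosed.exists_pow_nat_eq (-(1 / 4) : K) (show 0 < 4 by norm_num)
  obtain ⟨σ, hσ⟩ := exists_isParametrization_some_zero_of_pow_four hc
  obtain ⟨ρ, hρ⟩ := exists_isParametrization_some_zero_smooth (K := K)
  obtain ⟨h1, h2⟩ := isDistinguishedAt_toPoly_some_zero (-3 / 4 : K)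
  refine encard_localBranches_eq_two h1 h2 hσ hρ fun heq => ?_
  -- A common minimal polynomial would have degree at least 4 because of σ, and at most 1 because ρ
  -- is a series in z.
  have h4 := hσ.le_natDegree_minpoly h1.monic
  have hroot : Polynomial.aeval (Ramified.of 1 ρ) (Polynomial.X - Polynomial.C ρ) = 0 := by
    rw [map_sub, Polynomial.aeval_X, Polynomial.aeval_C, Ramified.algebraMap_apply,
      PowerSeries.expand_one_apply]
    exact sub_self (Ramified.of 1 ρ)
  have h5 := Polynomial.natDegree_le_of_dvd
    (minpoly.isIntegrallyClosed_dvd (hρ.isIntegral h1.monic) hroot) (Polynomial.X_sub_C_ne_zero ρ)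
  rw [heq] at h4
  rw [Polynomial.natDegree_X_sub_C] at h5
  omega

theorem encard_localBranches_none_critical :
    (localBranches (fibreGerm (p K) none (-5 / 8))).encard = 2 := by
  classical
  -- The discriminant of l^2 + (15/4)l + 55/16 is 5/16.
  obtain ⟨r, hr⟩ := IsAlgClosed.exists_pow_nat_eq (5 : K) (zero_lt_two)
  have hr0 : r ≠ 0 := by
    rintro rfl
    norm_num at hr
  obtain ⟨σ, hσ, hσ5, hσ7⟩ := exists_isParametrization_none_of_eq (l := (-15 + r) / 8)
    (by linear_combination hr / 64)
    (by
      rw [show 2 * ((-15 + r) / 8) + 15 / 4 = r / 4 by ring]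
      exact div_ne_zero hr0 (by norm_num))
  obtain ⟨ρ, hρ, hρ5, hρ7⟩ := exists_isParametrization_none_of_eq (l := (-15 - r) / 8)
    (by linear_combination hr / 64)
    (by
      rw [show 2 * ((-15 - r) / 8) + 15 / 4 = -r / 4 by ring]
      exact div_ne_zero (neg_ne_zero.2 hr0) (by norm_num))
  obtain ⟨h1, h2⟩ := isDistinguishedAt_toPoly_none (-5 / 8 : K)
  refine encard_localBranches_eq_two h1 h2 hσ hρ fun heq => ?_
  have hm := minpoly.monic (hσ.isIntegral h1.monic)
  -- If the minimal polynomials agreed, a polynomial of degree at most 3 would have four roots: the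
  -- three conjugates of σ, and ρ.
  have hle : (minpoly (PowerSeries K) (Ramified.of 3 σ)).natDegree ≤ 3 := by
    obtain ⟨H, hH, hdeg, hroot⟩ := exists_monic_cubic σ
    exact (Polynomial.natDegree_le_of_dvd
      (minpoly.isIntegrallyClosed_dvd (hσ.isIntegral h1.monic) hroot) hH.ne_zero).trans hdeg.le
  -- Equal coefficients of τ^5 force ω = 1, while the coefficients of τ^7 differ by r/12.
  have hρmem : ρ ∉ conjugates 3 σ := by
    rw [mem_conjugates]
    rintro ⟨ω, hω, rfl⟩
    rw [PowerSeries.coeff_rescale, hσ5, mul_one] at hρ5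
    have hω1 : ω = 1 := by
      calc ω = ω ^ 3 * ω ^ 3 := by rw [← pow_add, pow_succ, hρ5, one_mul]
        _ = 1 := by rw [hω, one_mul]
    rw [PowerSeries.coeff_rescale, hσ7, hω1, one_pow] at hρ7
    apply hr0
    linear_combination 12 * hρ7
  have hcard := card_le_natDegree (S := insert ρ (conjugates 3 σ)) hm fun s hs => by
    rcases Finset.mem_insert.1 hs with rfl | hs
    · rw [heq]
      exact minpoly.aeval _ _
    · exact aeval_of_mem_conjugates (minpoly.aeval _ _) hs
  rw [Finset.card_insert_of_notMem hρmem, card_conjugates hσ.coprime hσ.coeff_ne_zero] at hcard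
  omega

theorem encard_branchesAtInfinity_eq_two {t : K} (h : t ≠ -5 / 8) (h' : t ≠ -3 / 4) :
    (branchesAtInfinity (p K - MvPolynomial.C t)).encard = 2 := by
  rw [encard_branchesAtInfinity_p_sub_C, encard_localBranches_none h,
    encard_localBranches_some_zero h']
  rfl

theorem encard_branchesAtInfinity_p : (branchesAtInfinity (p K)).encard = 2 := by
  have := encard_branchesAtInfinity_eq_two (K := K) (t := 0) (by norm_num) (by norm_num)
  simpa using this

theorem encard_branchesAtInfinity_first :
    (branchesAtInfinity (p K - MvPolynomial.C (-5 / 8))).encard = 3 := by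
  rw [encard_branchesAtInfinity_p_sub_C, encard_localBranches_none_critical,
    encard_localBranches_some_zero (by norm_num)]
  rfl

theorem encard_branchesAtInfinity_second :
    (branchesAtInfinity (p K - MvPolynomial.C (-3 / 4))).encard = 3 := by
  rw [encard_branchesAtInfinity_p_sub_C, encard_localBranches_none (by norm_num),
    encard_localBranches_some_zero_critical]
  rfl

end

end AtInfinity

/-! ### The affine singular point. -/

namespace AtInfinity

noncomputable section

variable {K : Type*} [Field K]

open MvPolynomial

theorem pderiv_zero_p : pderiv 0 (p K) =
    6 * X 0 ^ 5 * X 1 ^ 5 - 25 * X 0 ^ 4 * X 1 ^ 4 + 40 * X 0 ^ 3 * X 1 ^ 3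
      - 6 * X 0 ^ 2 * X 1 ^ 3 - 30 * X 0 ^ 2 * X 1 ^ 2 + 10 * X 0 * X 1 ^ 2 + 10 * X 0 * X 1
      - C (15 / 4) * X 1 - 1 := by
  have h : ∀ n : ℕ, [n.AtLeastTwo] →
      pderiv 0 (ofNat(n) : MvPolynomial (Fin 2) K) = 0 := fun n _ => by
    rw [← map_ofNat C n, pderiv_C]
  simp only [p, map_add, map_sub, Derivation.leibniz, Derivation.leibniz_pow, pderiv_X_self,
    pderiv_X_of_ne (show (1 : Fin 2) ≠ 0 by decide), pderiv_C, h, smul_eq_mul, nsmul_eq_mul]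
  push_cast
  ring

theorem pderiv_one_p : pderiv 1 (p K) =
    5 * X 0 ^ 6 * X 1 ^ 4 - 20 * X 0 ^ 5 * X 1 ^ 3 + 30 * X 0 ^ 4 * X 1 ^ 2
      - 6 * X 0 ^ 3 * X 1 ^ 2 - 20 * X 0 ^ 3 * X 1 + 10 * X 0 ^ 2 * X 1 + 5 * X 0 ^ 2
      - C (15 / 4) * X 0 + 1 := by
  have h : ∀ n : ℕ, [n.AtLeastTwo] →
      pderiv 1 (ofNat(n) : MvPolynomial (Fin 2) K) = 0 := fun n _ => by
    rw [← map_ofNat C n, pderiv_C]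
  simp only [p, map_add, map_sub, Derivation.leibniz, Derivation.leibniz_pow, pderiv_X_self,
    pderiv_X_of_ne (show (0 : Fin 2) ≠ 1 by decide), pderiv_C, h, smul_eq_mul, nsmul_eq_mul]
  push_cast
  ring

theorem isSingularAt_p_iff (v : Fin 2 → K) : IsSingularAt (p K) v ↔
    (6 * v 0 ^ 5 * v 1 ^ 5 - 25 * v 0 ^ 4 * v 1 ^ 4 + 40 * v 0 ^ 3 * v 1 ^ 3
      - 6 * v 0 ^ 2 * v 1 ^ 3 - 30 * v 0 ^ 2 * v 1 ^ 2 + 10 * v 0 * v 1 ^ 2 + 10 * v 0 * v 1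
      - 15 / 4 * v 1 - 1 = 0) ∧
    (5 * v 0 ^ 6 * v 1 ^ 4 - 20 * v 0 ^ 5 * v 1 ^ 3 + 30 * v 0 ^ 4 * v 1 ^ 2
      - 6 * v 0 ^ 3 * v 1 ^ 2 - 20 * v 0 ^ 3 * v 1 + 10 * v 0 ^ 2 * v 1 + 5 * v 0 ^ 2
      - 15 / 4 * v 0 + 1 = 0) := by
  rw [IsSingularAt, Fin.forall_fin_two, pderiv_zero_p, pderiv_one_p]
  simp

variable [CharZero K]

theorem isSingularAt_p_iff_eq (v : Fin 2 → K) :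
    IsSingularAt (p K) v ↔ v = ![-900, -4 / 3375] := by
  rw [isSingularAt_p_iff]
  constructor
  · rintro ⟨h1, h2⟩
    obtain ⟨x, hx⟩ : ∃ x, v 0 = x := ⟨_, rfl⟩
    obtain ⟨y, hy⟩ : ∃ y, v 1 = y := ⟨_, rfl⟩
    obtain ⟨q, hq⟩ : ∃ q, x * y - 1 = q := ⟨_, rfl⟩
    rw [hx, hy] at h1 h2
    -- x∂x - y∂y multiplies x^i y^j by i - j, so it sends x(xy-1)^5 + g(xy) + y to x(xy-1)^5 - y.
    have e1 : x * q ^ 5 = y := by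
      rw [← hq]
      linear_combination x * h1 - y * h2
    have e2 : 5 * x ^ 2 * q ^ 4 + x * (-6 * q ^ 2 - 2 * q + 1 / 4) + 1 = 0 := by
      rw [← hq]
      linear_combination h2
    have e3 : x ^ 2 * q ^ 5 = q + 1 := by
      linear_combination x * e1 + hq
    have e4 : x * (q * (-6 * q ^ 2 - 2 * q + 1 / 4)) = -(6 * q + 5) := by
      linear_combination q * e2 - 5 * e3
    -- Put m = -6q^2 - 2q + 1/4. The square of `e4` together with `e3` gives q^3(6q+5)^2 = (q+1)m^2.
    -- All terms of degree at least 2 in q cancel, and 15q = 1 remains.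
    have hq1 : q = 1 / 15 := by
      linear_combination 16 / 15 * (-6 * q ^ 2 - 2 * q + 1 / 4) ^ 2 * e3
        - 16 / 15 * q ^ 3 * (x * (q * (-6 * q ^ 2 - 2 * q + 1 / 4)) - (6 * q + 5)) * e4
    rw [hq1] at e4 e1
    have hx1 : x = -900 := by
      linear_combination 500 / 3 * e4
    rw [hx1] at e1
    ext i
    fin_cases i
    · simpa [hx1] using hx
    · simp only [Fin.mk_one, hy, ← e1]
      norm_num
  · rintro rfl
    norm_num

theorem isOrdinaryDoublePoint_p : IsOrdinaryDoublePoint (p K) ![-900, -4 / 3375] := by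
  refine ⟨(isSingularAt_p_iff_eq _).2 rfl, ?_⟩
  have h : ∀ (i : Fin 2) (n : ℕ), [n.AtLeastTwo] →
      pderiv i (ofNat(n) : MvPolynomial (Fin 2) K) = 0 := fun i n _ => by
    rw [← map_ofNat C n, pderiv_C]
  rw [Matrix.det_fin_two]
  simp only [hessian, Matrix.of_apply, pderiv_zero_p, pderiv_one_p]
  simp only [map_add, map_sub, Derivation.leibniz, Derivation.leibniz_pow, pderiv_X_self,
    pderiv_X_of_ne (show (0 : Fin 2) ≠ 1 by decide),
    pderiv_X_of_ne (show (1 : Fin 2) ≠ 0 by decide), pderiv_C, h, pderiv_one, smul_eq_mul,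
    nsmul_eq_mul, map_mul, map_pow, eval_X, map_natCast, eval_C, map_ofNat, map_zero, map_one]
  norm_num

theorem eval_p_singular : eval ![-900, -4 / 3375] (p K) = -20 / 27 := by
  simp only [p, map_add, map_sub, map_mul, map_pow, eval_X, eval_C, map_ofNat]
  norm_num

theorem p_eq : p K = ((X 0 ^ 3 * X 1 ^ 2 - 1) ^ 2 * X 1 + (X 0 * X 1 - 1) ^ 5 * X 0
    - X 0 ^ 6 * X 1 ^ 5 + 5 * X 0 * X 1 * (X 0 * X 1 - C (3 / 4))) := by
  have h : (C (15 / 4) : MvPolynomial (Fin 2) K) = 5 * C (3 / 4) := by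
    rw [← map_ofNat C 5, ← map_mul]
    norm_num
  simp only [p, h]
  ring

end

end AtInfinity

/-! ### Initial forms, read off on the charts of a blow-up. -/

namespace AtInfinity

noncomputable section

open MvPolynomial

variable {K : Type*} [Field K]

/-- The restriction of a polynomial to the exceptional curve, in the coordinates of `blowUp d`. -/
def restrictExc : Option K → MvPolynomial (Fin 2) K →ₐ[K] Polynomial K
  | some _ => aeval ![0, Polynomial.X]
  | none => aeval ![Polynomial.X, 0]

/-- The restriction of a form to the exceptional curve, in the coordinate centred at `d`. -/
def dehomogenize : Option K → MvPolynomial (Fin 2) K →ₐ[K] Polynomial K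
  | some c => aeval ![1, Polynomial.X + Polynomial.C c]
  | none => aeval ![Polynomial.X, 1]

theorem restrictExc_X_excIndex (d : Option K) : restrictExc d (X (excIndex d)) = 0 := by
  cases d <;> simp [restrictExc, excIndex]

theorem restrictExc_aeval (d : Option K) (q : Polynomial K) :
    restrictExc d (Polynomial.aeval (X (tangentIndex d)) q) = q := by
  rw [← Polynomial.aeval_algHom_apply]
  cases d <;> simp [restrictExc, tangentIndex]

theorem coeff_zero_restrictExc (d : Option K) (F : MvPolynomial (Fin 2) K) :
    (restrictExc d F).coeff 0 = constantCoeff F := by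
  induction F using MvPolynomial.induction_on with
  | C c => cases d <;> simp [restrictExc]
  | add F G hF hG => rw [map_add, Polynomial.coeff_add, hF, hG, map_add]
  | mul_X F i hF =>
    rw [map_mul, map_mul, Polynomial.mul_coeff_zero, constantCoeff_X]
    cases d <;> fin_cases i <;> simp [restrictExc]

theorem coeff_one_restrictExc (d : Option K) (F : MvPolynomial (Fin 2) K) :
    (restrictExc d F).coeff 1 = coeff (Finsupp.single (tangentIndex d) 1) F := by
  induction F using MvPolynomial.induction_on with
  | C c =>
    rw [coeff_C, if_neg (Finsupp.single_ne_zero.2 one_ne_zero).symm]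
    cases d <;> simp [restrictExc]
  | add F G hF hG => rw [map_add, Polynomial.coeff_add, hF, hG, coeff_add]
  | mul_X F i hF =>
    have h0 := coeff_zero_restrictExc d F
    rw [map_mul, coeff_mul_X']
    cases d <;> fin_cases i <;>
      simp_all [restrictExc, tangentIndex, constantCoeff_eq]

theorem restrictExc_blowUp (d : Option K) (F : MvPolynomial (Fin 2) K) :
    restrictExc d (blowUp d F) = Polynomial.C (constantCoeff F) := by
  induction F using MvPolynomial.induction_on with
  | C c => cases d <;> simp [restrictExc, blowUp]
  | add F G hF hG => simp only [map_add, hF, hG]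
  | mul_X F i hF =>
    rw [map_mul, map_mul, hF]
    cases d <;> fin_cases i <;> simp [restrictExc, blowUp]

theorem constantCoeff_blowUp (d : Option K) (F : MvPolynomial (Fin 2) K) :
    constantCoeff (blowUp d F) = constantCoeff F := by
  rw [← coeff_zero_restrictExc d, restrictExc_blowUp, Polynomial.coeff_C_zero]

/-- The chart covers every point off the image line of the exceptional equation, so F times that
equation vanishes at all points of the plane over an infinite field. -/
theorem blowUp_injective [Infinite K] (d : Option K) :
    Function.Injective (blowUp d : MvPolynomial (Fin 2) K → MvPolynomial (Fin 2) K) := by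
  rw [injective_iff_map_eq_zero]
  intro F hF
  have key : ∀ v : Fin 2 → K, v (excIndex d) ≠ 0 → eval v F = 0 := by
    intro v hv
    obtain ⟨u, hu⟩ : ∃ u, (fun i => eval u (blowUp d (X i))) = v := by
      rcases d with _ | c
      · refine ⟨![v 0 / v 1, v 1], funext fun i => ?_⟩
        have hv : v 1 ≠ 0 := hv
        fin_cases i <;> simp [blowUp, hv]
      · refine ⟨![v 0, v 1 / v 0 - c], funext fun i => ?_⟩
        have hv : v 0 ≠ 0 := hv
        fin_cases i <;> simp [blowUp, hv, mul_div_cancel₀]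
    have h : (aeval u).comp (blowUp d) = (aeval v : MvPolynomial (Fin 2) K →ₐ[K] K) := by
      ext i
      have := congrFun hu i
      simpa [aeval_eq_eval] using this
    have h2 := DFunLike.congr_fun h F
    rw [AlgHom.comp_apply, hF, map_zero] at h2
    exact h2.symm
  have h : X (excIndex d) * F = 0 := by
    refine MvPolynomial.funext fun v => ?_
    rw [map_mul, eval_X, map_zero]
    by_cases hv : v (excIndex d) = 0
    · rw [hv, zero_mul]
    · rw [key v hv, mul_zero]
  exact (mul_eq_zero.1 h).resolve_left (X_ne_zero _)

theorem blowUp_of_isHomogeneous (d : Option K) {H : MvPolynomial (Fin 2) K} {n : ℕ}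
    (hH : H.IsHomogeneous n) :
    blowUp d H = X (excIndex d) ^ n *
      Polynomial.aeval (X (tangentIndex d)) (dehomogenize d H) := by
  rw [H.as_sum, map_sum, map_sum, map_sum, Finset.mul_sum]
  refine Finset.sum_congr rfl fun m hm => ?_
  have hdeg : m 0 + m 1 = n := by
    have := hH (mem_support_iff.1 hm)
    rw [Finsupp.weight_apply, Finsupp.sum_fintype _ _ (by simp)] at this
    simpa using this
  have hmon : monomial m (coeff m H) = C (coeff m H) * (X 0 ^ m 0 * X 1 ^ m 1) := by
    rw [monomial_eq, Finsupp.prod_fintype _ _ (by simp), Fin.prod_univ_two]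
  rw [hmon, ← hdeg]
  cases d <;>
    simp only [blowUp, dehomogenize, excIndex, tangentIndex, map_mul, map_pow, aeval_X, map_add,
      Polynomial.aeval_X, Polynomial.aeval_C, algHom_C, Matrix.cons_val_zero, Matrix.cons_val_one,
      one_pow, algebraMap_eq, mul_pow, pow_add, Polynomial.algebraMap_eq, one_mul,
      mul_one] <;> ring

/-- `H` is the lowest order form of `F`, and `n` is its degree. -/
structure HasInitialForm (F : MvPolynomial (Fin 2) K) (n : ℕ) (H : MvPolynomial (Fin 2) K) :
    Prop where
  isHomogeneous : H.IsHomogeneous n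
  ne_zero : H ≠ 0
  -- Stated through blow-ups rather than homogeneous components: for an explicit F the factorization
  -- is a polynomial identity.
  exists_blowUp_eq : ∀ d, ∃ G, blowUp d F = X (excIndex d) ^ n * G ∧
    restrictExc d G = dehomogenize d H

theorem hasInitialForm_ord {F : MvPolynomial (Fin 2) K} (hF : F ≠ 0) :
    HasInitialForm F (ord F) (homogeneousComponent (ord F) F) := by
  have hne : homogeneousComponent (ord F) F ≠ 0 := by
    refine Nat.sInf_mem (s := {n | homogeneousComponent n F ≠ 0}) ?_
    by_contra! h
    apply hF
    rw [← sum_homogeneousComponent F]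
    refine Finset.sum_eq_zero fun i _ => ?_
    by_contra hi
    exact (h ▸ hi : i ∈ (∅ : Set ℕ))
  have hlt : ∀ n < ord F, homogeneousComponent n F = 0 := fun n hn => by
    by_contra h
    exact Nat.notMem_of_lt_sInf hn h
  refine ⟨homogeneousComponent_isHomogeneous _ _, hne, fun d => ?_⟩
  let g (n : ℕ) : MvPolynomial (Fin 2) K :=
    Polynomial.aeval (X (tangentIndex d)) (dehomogenize d (homogeneousComponent n F))
  have hg : ∀ n < ord F, g n = 0 := fun n hn => by simp only [g, hlt n hn, map_zero]
  have hle : ord F ≤ F.totalDegree := by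
    by_contra! h
    exact hne (homogeneousComponent_eq_zero _ _ h)
  obtain ⟨N, hN⟩ : ∃ N, F.totalDegree + 1 = ord F + (N + 1) :=
    ⟨F.totalDegree - ord F, by omega⟩
  refine ⟨∑ i ∈ Finset.range (N + 1), X (excIndex d) ^ i * g (ord F + i), ?_, ?_⟩
  · conv_lhs => rw [← sum_homogeneousComponent F, map_sum, hN, Finset.sum_range_add]
    rw [Finset.sum_eq_zero, zero_add, Finset.mul_sum]
    · refine Finset.sum_congr rfl fun i _ => ?_
      rw [blowUp_of_isHomogeneous d (homogeneousComponent_isHomogeneous _ _), pow_add, mul_assoc]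
    · intro i hi
      rw [hlt i (Finset.mem_range.1 hi), map_zero]
  · rw [map_sum, Finset.sum_range_succ', Finset.sum_eq_zero, zero_add, pow_zero, one_mul, add_zero,
      restrictExc_aeval]
    intro i _
    rw [pow_succ, mul_assoc, map_mul, map_mul, restrictExc_X_excIndex, zero_mul, mul_zero]

theorem HasInitialForm.mul {F F' H H' : MvPolynomial (Fin 2) K} {n n' : ℕ}
    (h : HasInitialForm F n H) (h' : HasInitialForm F' n' H') :
    HasInitialForm (F * F') (n + n') (H * H') := by
  refine ⟨h.isHomogeneous.mul h'.isHomogeneous, mul_ne_zero h.ne_zero h'.ne_zero, fun d => ?_⟩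
  obtain ⟨G, h1, h2⟩ := h.exists_blowUp_eq d
  obtain ⟨G', h1', h2'⟩ := h'.exists_blowUp_eq d
  refine ⟨G * G', ?_, by rw [map_mul, map_mul, h2, h2']⟩
  rw [map_mul, h1, h1', pow_add]
  ring

theorem HasInitialForm.of_isHomogeneous {H : MvPolynomial (Fin 2) K} {n : ℕ}
    (hH : H.IsHomogeneous n) (h0 : H ≠ 0) : HasInitialForm H n H :=
  ⟨hH, h0, fun d => ⟨_, blowUp_of_isHomogeneous d hH, restrictExc_aeval _ _⟩⟩

theorem HasInitialForm.of_constantCoeff_ne_zero {F : MvPolynomial (Fin 2) K}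
    (h : constantCoeff F ≠ 0) : HasInitialForm F 0 (C (constantCoeff F)) := by
  refine ⟨isHomogeneous_C _ _, by rwa [Ne, C_eq_zero], fun d => ⟨blowUp d F, by simp, ?_⟩⟩
  rw [restrictExc_blowUp]
  cases d <;> simp [dehomogenize]

/-- A nonzero restriction to the exceptional curve means that no further power of its equation
divides, so the exponents agree. -/
theorem eq_of_X_pow_mul_eq {d : Option K} {n m : ℕ} {G G' : MvPolynomial (Fin 2) K}
    (h : X (excIndex d) ^ n * G = X (excIndex d) ^ m * G') (hG : restrictExc d G ≠ 0)
    (hG' : restrictExc d G' ≠ 0) : n = m ∧ G = G' := by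
  have aux : ∀ {n m : ℕ} {G G' : MvPolynomial (Fin 2) K},
      X (excIndex d) ^ n * G = X (excIndex d) ^ m * G' → restrictExc d G ≠ 0 → m ≤ n := by
    intro n m G G' h hG
    by_contra! hlt
    obtain ⟨k, rfl⟩ := Nat.exists_eq_add_of_lt hlt
    rw [pow_succ, pow_add, mul_assoc, mul_assoc] at h
    apply hG
    rw [mul_left_cancel₀ (pow_ne_zero _ (X_ne_zero _)) h, map_mul, map_mul,
      restrictExc_X_excIndex, zero_mul, mul_zero]
  obtain rfl := le_antisymm (aux h.symm hG') (aux h hG)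
  exact ⟨rfl, mul_left_cancel₀ (pow_ne_zero _ (X_ne_zero _)) h⟩

variable [Infinite K]

theorem dehomogenize_injOn (d : Option K) {H H' : MvPolynomial (Fin 2) K} {n : ℕ}
    (hH : H.IsHomogeneous n) (hH' : H'.IsHomogeneous n)
    (h : dehomogenize d H = dehomogenize d H') : H = H' :=
  blowUp_injective d (by rw [blowUp_of_isHomogeneous d hH, blowUp_of_isHomogeneous d hH', h])

theorem dehomogenize_ne_zero (d : Option K) {H : MvPolynomial (Fin 2) K} {n : ℕ}
    (hH : H.IsHomogeneous n) (h0 : H ≠ 0) : dehomogenize d H ≠ 0 := fun h =>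
  h0 (dehomogenize_injOn d hH (isHomogeneous_zero _ _ _) (h.trans (map_zero _).symm))

namespace HasInitialForm

variable {F F' H H' : MvPolynomial (Fin 2) K} {n n' : ℕ}

theorem unique_of_blowUp_eq (h : HasInitialForm F n H) {d : Option K} {m : ℕ}
    {G : MvPolynomial (Fin 2) K} (hG : blowUp d F = X (excIndex d) ^ m * G)
    (h0 : restrictExc d G ≠ 0) : m = n ∧ restrictExc d G = dehomogenize d H := by
  obtain ⟨G', h1, h2⟩ := h.exists_blowUp_eq d
  obtain ⟨rfl, rfl⟩ := eq_of_X_pow_mul_eq (hG.symm.trans h1) h0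
    (h2 ▸ dehomogenize_ne_zero d h.isHomogeneous h.ne_zero)
  exact ⟨rfl, h2⟩

theorem right_ne_zero (h : HasInitialForm F n H) : F ≠ 0 := by
  rintro rfl
  obtain ⟨G, h1, h2⟩ := h.exists_blowUp_eq none
  rw [map_zero] at h1
  have h3 := (mul_eq_zero.1 h1.symm).resolve_left (pow_ne_zero _ (X_ne_zero _))
  rw [h3, map_zero] at h2
  exact dehomogenize_ne_zero none h.isHomogeneous h.ne_zero h2.symm

theorem unique (h : HasInitialForm F n H) (h' : HasInitialForm F n' H') : n = n' ∧ H = H' := by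
  obtain ⟨G, h1, h2⟩ := h.exists_blowUp_eq none
  obtain ⟨rfl, h3⟩ := h'.unique_of_blowUp_eq h1
    (h2 ▸ dehomogenize_ne_zero none h.isHomogeneous h.ne_zero)
  exact ⟨rfl, dehomogenize_injOn none h.isHomogeneous h'.isHomogeneous (h2.symm.trans h3)⟩

theorem ord_eq (h : HasInitialForm F n H) : ord F = n :=
  ((hasInitialForm_ord h.right_ne_zero).unique h).1

theorem initialPoly_eq (h : HasInitialForm F n H) :
    initialPoly F = dehomogenize (some 0) H := by
  rw [initialPoly, ((hasInitialForm_ord h.right_ne_zero).unique h).2]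
  simp [dehomogenize]

/-- A single chart suffices, because a form of known degree is determined by its dehomogenization in
any chart. -/
theorem of_blowUp_eq {d : Option K} {G : MvPolynomial (Fin 2) K} (hH : H.IsHomogeneous n)
    (h0 : H ≠ 0) (h1 : blowUp d F = X (excIndex d) ^ n * G)
    (h2 : restrictExc d G = dehomogenize d H) : HasInitialForm F n H := by
  have hG : restrictExc d G ≠ 0 := h2 ▸ dehomogenize_ne_zero d hH h0
  have hF : F ≠ 0 := by
    rintro rfl
    rw [map_zero] at h1
    have h3 := (mul_eq_zero.1 h1.symm).resolve_left (pow_ne_zero _ (X_ne_zero _))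
    rw [h3, map_zero] at hG
    exact hG rfl
  have h := hasInitialForm_ord hF
  obtain ⟨hn, h4⟩ := h.unique_of_blowUp_eq h1 hG
  have h5 : H = homogeneousComponent (ord F) F :=
    dehomogenize_injOn d hH (hn ▸ h.isHomogeneous) (h2.symm.trans h4)
  rwa [← h5, ← hn] at h

end HasInitialForm

theorem strictStep_eq {F G : MvPolynomial (Fin 2) K} {d : Option K} {n : ℕ}
    (h : blowUp d F = X (excIndex d) ^ n * G) (hG : restrictExc d G ≠ 0) : strictStep F d = G := by
  have hF : F ≠ 0 := by
    rintro rfl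
    rw [map_zero] at h
    have h3 := (mul_eq_zero.1 h.symm).resolve_left (pow_ne_zero _ (X_ne_zero _))
    rw [h3, map_zero] at hG
    exact hG rfl
  rw [strictStep, ← ((hasInitialForm_ord hF).unique_of_blowUp_eq h hG).1, h, X_pow_eq_monomial,
    divMonomial_monomial_mul]

end

end AtInfinity

/-! ### Dicriticals of a quotient of two germs; typical fibres. -/

namespace AtInfinity

noncomputable section

open MvPolynomial

variable {K : Type*} [Field K]

theorem totalTransform_cons (d : Option K) (w : List (Option K)) (F : MvPolynomial (Fin 2) K) :
    totalTransform (d :: w) F = totalTransform w (blowUp d F) := rfl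

theorem strictTransform_cons (d : Option K) (w : List (Option K)) (F : MvPolynomial (Fin 2) K) :
    strictTransform (d :: w) F = strictTransform w (strictStep F d) := rfl

theorem strictTransform_append_singleton (w : List (Option K)) (d : Option K)
    (F : MvPolynomial (Fin 2) K) :
    strictTransform (w ++ [d]) F = strictStep (strictTransform w F) d := by
  simp [strictTransform]

theorem totalTransform_mul (w : List (Option K)) (F G : MvPolynomial (Fin 2) K) :
    totalTransform w (F * G) = totalTransform w F * totalTransform w G := by
  induction w generalizing F G with
  | nil => rfl
  | cons d w ih => simp only [totalTransform_cons, map_mul, ih]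

theorem totalTransform_ne_zero [Infinite K] (w : List (Option K)) {F : MvPolynomial (Fin 2) K}
    (hF : F ≠ 0) : totalTransform w F ≠ 0 := by
  induction w generalizing F with
  | nil => exact hF
  | cons d w ih => exact ih fun h => hF (blowUp_injective d (h.trans (map_zero _).symm))

theorem constantCoeff_totalTransform (w : List (Option K)) (F : MvPolynomial (Fin 2) K) :
    constantCoeff (totalTransform w F) = constantCoeff F := by
  induction w generalizing F with
  | nil => rfl
  | cons d w ih => rw [totalTransform_cons, ih, constantCoeff_blowUp]

/-- The rational function `P / Q` is not constant on the curve `E_w`. -/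
def IsDicriticalPair (w : List (Option K)) (P Q : MvPolynomial (Fin 2) K) : Prop :=
  ord (totalTransform w P) = ord (totalTransform w Q) ∧
    restrictTo w P Q ∉ Set.range (RatFunc.C : K →+* RatFunc K)

theorem isDicritical_iff (f : MvPolynomial (Fin 2) K) (a : Option K) (w : List (Option K)) :
    IsDicritical f a w ↔ IsDicriticalPair w (germ f a) (poleGerm f) := Iff.rfl

theorem isDicriticalPair_cons (d : Option K) (w : List (Option K))
    (P Q : MvPolynomial (Fin 2) K) :
    IsDicriticalPair (d :: w) P Q ↔ IsDicriticalPair w (blowUp d P) (blowUp d Q) := Iff.rfl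

/-- All dicriticals of `P / Q` lie over the infinitely near point `w`, at which `P / Q` is the
quotient of `P'` and `Q'`. -/
structure Leads (w : List (Option K)) (P Q P' Q' : MvPolynomial (Fin 2) K) : Prop where
  exists_eq : ∃ M, M ≠ 0 ∧ totalTransform w P = M * P' ∧ totalTransform w Q = M * Q'
  isDicriticalPair_iff : ∀ w', IsDicriticalPair w' P Q ↔
    ∃ w'', w' = w ++ w'' ∧ IsDicriticalPair w'' P' Q'

theorem Leads.nil {P Q : MvPolynomial (Fin 2) K} : Leads [] P Q P Q :=
  ⟨⟨1, one_ne_zero, (one_mul _).symm, (one_mul _).symm⟩, fun w' => by simp⟩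

theorem isDicriticalPair_comm {w : List (Option K)} {P Q : MvPolynomial (Fin 2) K} :
    IsDicriticalPair w P Q ↔ IsDicriticalPair w Q P := by
  have aux : ∀ {P Q : MvPolynomial (Fin 2) K}, IsDicriticalPair w P Q →
      IsDicriticalPair w Q P := by
    rintro P Q ⟨h1, h2⟩
    refine ⟨h1.symm, ?_⟩
    rintro ⟨c, hc⟩
    refine h2 ⟨c⁻¹, ?_⟩
    rw [map_inv₀, hc, restrictTo, restrictTo, inv_div]
  exact ⟨aux, aux⟩

variable [Infinite K] {P Q : MvPolynomial (Fin 2) K}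

theorem ord_mul {F G : MvPolynomial (Fin 2) K} (hF : F ≠ 0) (hG : G ≠ 0) :
    ord (F * G) = ord F + ord G :=
  ((hasInitialForm_ord hF).mul (hasInitialForm_ord hG)).ord_eq

theorem initialPoly_mul {F G : MvPolynomial (Fin 2) K} (hF : F ≠ 0) (hG : G ≠ 0) :
    initialPoly (F * G) = initialPoly F * initialPoly G := by
  have h1 := hasInitialForm_ord hF
  have h2 := hasInitialForm_ord hG
  rw [(h1.mul h2).initialPoly_eq, map_mul, h1.initialPoly_eq, h2.initialPoly_eq]

theorem initialPoly_ne_zero {F : MvPolynomial (Fin 2) K} (hF : F ≠ 0) : initialPoly F ≠ 0 := by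
  have h := hasInitialForm_ord hF
  rw [h.initialPoly_eq]
  exact dehomogenize_ne_zero _ h.isHomogeneous h.ne_zero

theorem restrictTo_mul_left (w : List (Option K)) {M : MvPolynomial (Fin 2) K} (hM : M ≠ 0)
    (hP : P ≠ 0) (hQ : Q ≠ 0) : restrictTo w (M * P) (M * Q) = restrictTo w P Q := by
  have hM' := totalTransform_ne_zero w hM
  rw [restrictTo, restrictTo, totalTransform_mul, totalTransform_mul,
    initialPoly_mul hM' (totalTransform_ne_zero w hP),
    initialPoly_mul hM' (totalTransform_ne_zero w hQ), map_mul, map_mul, mul_div_mul_left]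
  rw [Ne, FaithfulSMul.algebraMap_eq_zero_iff]
  exact initialPoly_ne_zero hM'

theorem isDicriticalPair_mul_left (w : List (Option K)) {M : MvPolynomial (Fin 2) K} (hM : M ≠ 0)
    (hP : P ≠ 0) (hQ : Q ≠ 0) :
    IsDicriticalPair w (M * P) (M * Q) ↔ IsDicriticalPair w P Q := by
  have hM' := totalTransform_ne_zero w hM
  rw [IsDicriticalPair, restrictTo_mul_left w hM hP hQ, totalTransform_mul, totalTransform_mul,
    ord_mul hM' (totalTransform_ne_zero w hP), ord_mul hM' (totalTransform_ne_zero w hQ),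
    add_right_inj, IsDicriticalPair]

/-- With different orders P/Q is 0 or ∞ on the exceptional curve; with equal orders it is the
constant c. -/
theorem not_isDicriticalPair_nil {n m : ℕ} {H H' : MvPolynomial (Fin 2) K}
    (hP : HasInitialForm P n H) (hQ : HasInitialForm Q m H') (h : n = m → ∃ c, H = C c * H') :
    ¬ IsDicriticalPair [] P Q := by
  rintro ⟨h1, h2⟩
  change ord P = ord Q at h1
  rw [hP.ord_eq, hQ.ord_eq] at h1
  obtain ⟨c, hc⟩ := h h1
  refine h2 ⟨c, ?_⟩
  change _ = algebraMap _ _ (initialPoly P) / algebraMap _ _ (initialPoly Q)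
  rw [eq_div_iff, hP.initialPoly_eq, hQ.initialPoly_eq, hc, map_mul, map_mul]
  · simp [dehomogenize]
  · rw [Ne, FaithfulSMul.algebraMap_eq_zero_iff]
    exact initialPoly_ne_zero hQ.right_ne_zero

/-- If `P / Q` is defined as a map to `ℙ¹` at the origin, then there are no dicriticals over it. -/
theorem not_isDicriticalPair_of_constantCoeff_ne_zero (w : List (Option K))
    (hQ : Q ≠ 0) (h : constantCoeff P ≠ 0) :
    ¬ IsDicriticalPair w P Q := by
  have h1 : constantCoeff (totalTransform w P) ≠ 0 := by rwa [constantCoeff_totalTransform]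
  have hP' := HasInitialForm.of_constantCoeff_ne_zero h1
  have h2 := hasInitialForm_ord (totalTransform_ne_zero w hQ)
  -- P pulls back to a unit, of order 0. Equal orders then force Q to be a unit too, and both
  -- initial forms are constants.
  refine not_isDicriticalPair_nil hP' h2 fun h0 => ?_
  have h3 : constantCoeff (totalTransform w Q) ≠ 0 := by
    have h4 := h2.isHomogeneous
    rw [← h0] at h4
    have h5 := h2.ne_zero
    rw [← h0, homogeneousComponent_zero, Ne, C_eq_zero] at h5
    exact h5
  refine ⟨constantCoeff (totalTransform w P) / constantCoeff (totalTransform w Q), ?_⟩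
  rw [← h0, homogeneousComponent_zero, ← map_mul]
  exact congrArg C (div_mul_cancel₀ _ h3).symm

/-- Off the tangent directions of P, dividing both pull-backs by the n-th power of the exceptional
equation turns P into a unit, and P/Q is defined there. -/
theorem HasInitialForm.not_isDicriticalPair {n m : ℕ} {H H' : MvPolynomial (Fin 2) K}
    (hP : HasInitialForm P n H) (hQ : HasInitialForm Q m H') (hnm : n ≤ m) (d : Option K)
    (hd : (dehomogenize d H).coeff 0 ≠ 0) (w : List (Option K)) :
    ¬ IsDicriticalPair (d :: w) P Q := by
  obtain ⟨k, rfl⟩ := Nat.exists_eq_add_of_le hnm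
  obtain ⟨G, h1, h2⟩ := hP.exists_blowUp_eq d
  obtain ⟨G', h1', h2'⟩ := hQ.exists_blowUp_eq d
  have h3 : constantCoeff G ≠ 0 := by rwa [← coeff_zero_restrictExc d, h2]
  have hG : G ≠ 0 := by
    rintro rfl
    simp at h3
  have hG' : G' ≠ 0 := by
    rintro rfl
    rw [map_zero] at h2'
    exact dehomogenize_ne_zero d hQ.isHomogeneous hQ.ne_zero h2'.symm
  have hX : ∀ i, (X (excIndex d) : MvPolynomial (Fin 2) K) ^ i ≠ 0 := fun i =>
    pow_ne_zero _ (X_ne_zero _)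
  rw [isDicriticalPair_cons, h1, h1', pow_add, mul_assoc,
    isDicriticalPair_mul_left w (hX n) hG (mul_ne_zero (hX k) hG')]
  exact not_isDicriticalPair_of_constantCoeff_ne_zero w (mul_ne_zero (hX k) hG') h3

/-- The resolution step. By `hc` the new exceptional curve is not dicritical, by `hd` no direction
other than d is tangent to P, and at d the common factor cancels. -/
theorem Leads.cons {d : Option K} {w : List (Option K)} {n m : ℕ}
    {H H' P₁ Q₁ P' Q' : MvPolynomial (Fin 2) K}
    (hH : H.IsHomogeneous n) (hH0 : H ≠ 0)
    (hQ : HasInitialForm Q m H')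
    (hnm : n ≤ m) (hc : n = m → ∃ c, H = C c * H')
    (hd : ∀ d', d' ≠ d → (dehomogenize d' H).coeff 0 ≠ 0)
    (hP₁ : blowUp d P = X (excIndex d) ^ n * P₁) (hPr : restrictExc d P₁ = dehomogenize d H)
    (hQ₁ : blowUp d Q = X (excIndex d) ^ n * Q₁)
    (h : Leads w P₁ Q₁ P' Q') : Leads (d :: w) P Q P' Q' := by
  have hP := HasInitialForm.of_blowUp_eq hH hH0 hP₁ hPr
  have hX : (X (excIndex d) : MvPolynomial (Fin 2) K) ^ n ≠ 0 := pow_ne_zero _ (X_ne_zero _)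
  have hP₁0 : P₁ ≠ 0 := by
    rintro rfl
    rw [mul_zero] at hP₁
    exact hP.right_ne_zero (blowUp_injective d (hP₁.trans (map_zero _).symm))
  have hQ₁0 : Q₁ ≠ 0 := by
    rintro rfl
    rw [mul_zero] at hQ₁
    exact hQ.right_ne_zero (blowUp_injective d (hQ₁.trans (map_zero _).symm))
  refine ⟨?_, fun w' => ?_⟩
  · obtain ⟨M, hM, h1, h2⟩ := h.exists_eq
    refine ⟨totalTransform w (X (excIndex d) ^ n) * M,
      mul_ne_zero (totalTransform_ne_zero w hX) hM, ?_, ?_⟩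
    · rw [totalTransform_cons, hP₁, totalTransform_mul, h1, mul_assoc]
    · rw [totalTransform_cons, hQ₁, totalTransform_mul, h2, mul_assoc]
  · rcases w' with _ | ⟨d', w'⟩
    · simpa using not_isDicriticalPair_nil hP hQ hc
    · by_cases hdd : d' = d
      · subst hdd
        rw [isDicriticalPair_cons, hP₁, hQ₁, isDicriticalPair_mul_left w' hX hP₁0 hQ₁0,
          h.isDicriticalPair_iff]
        simp
      · simp [hP.not_isDicriticalPair hQ hnm d' (hd d' hdd) w', hdd]

/-- The initial form of a germ of order one. -/
theorem HasInitialForm.linear (G : MvPolynomial (Fin 2) K) (β : K)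
    (h0 : constantCoeff G ≠ 0 ∨ β ≠ 0) : HasInitialForm (X 0 * G + C β * X 1) 1
      (C (constantCoeff G) * X 0 + C β * X 1) := by
  have hne : (C (constantCoeff G) * X 0 + C β * X 1 : MvPolynomial (Fin 2) K) ≠ 0 := by
    intro h
    have h1 := congrArg (eval ![1, 0]) h
    have h2 := congrArg (eval ![0, 1]) h
    simp at h1 h2
    exact h0.elim (· h1) (· h2)
  refine HasInitialForm.of_blowUp_eq (d := some 0) (G := blowUp (some 0) G + C β * X 1)
    ((isHomogeneous_C_mul_X _ _).add (isHomogeneous_C_mul_X _ _)) hne ?_ ?_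
  · simp only [map_add, map_mul]
    simp only [blowUp, excIndex, aeval_X, algHom_C, Matrix.cons_val_zero, Matrix.cons_val_one,
      algebraMap_eq, C_0]
    ring
  · rw [map_add, restrictExc_blowUp]
    simp [restrictExc, dehomogenize]

/-- P/Q restricts to the coordinate α + βv on the exceptional curve, of degree 1. At each point of
this curve one of the two strict transforms is a unit: P in the direction `none`, since β ≠ 0, and Q
in all others. -/
theorem isDicriticalPair_of_linear {α β : K}
    (hP : HasInitialForm P 1 (C α * X 0 + C β * X 1))
    (hQ : HasInitialForm Q 1 (C 1 * X 0 + C 0 * X 1)) (hβ : β ≠ 0) :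
    (∀ w, IsDicriticalPair w P Q ↔ w = []) ∧
      restrictTo [] P Q = algebraMap (Polynomial K) (RatFunc K)
        (Polynomial.C α + Polynomial.C β * Polynomial.X) := by
  have hr : restrictTo [] P Q = algebraMap (Polynomial K) (RatFunc K)
      (Polynomial.C α + Polynomial.C β * Polynomial.X) := by
    change algebraMap _ _ (initialPoly P) / algebraMap _ _ (initialPoly Q) = _
    rw [hP.initialPoly_eq, hQ.initialPoly_eq]
    simp [dehomogenize]
  refine ⟨fun w => ⟨fun hw => ?_, ?_⟩, hr⟩
  · rcases w with _ | ⟨d, w⟩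
    · rfl
    · rcases d with _ | c
      · exact absurd hw (hP.not_isDicriticalPair hQ le_rfl none (by simpa [dehomogenize] using hβ) w)
      · exact absurd (isDicriticalPair_comm.1 hw)
          (hQ.not_isDicriticalPair hP le_rfl (some c) (by simp [dehomogenize]) w)
  · rintro rfl
    refine ⟨hP.ord_eq.trans hQ.ord_eq.symm, ?_⟩
    rw [hr]
    rintro ⟨c, hc⟩
    rw [← RatFunc.algebraMap_C] at hc
    have h1 := RatFunc.algebraMap_injective K hc
    have h2 := congrArg (Polynomial.coeff · 1) h1
    simp [Polynomial.coeff_C] at h2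
    exact hβ h2.symm

theorem Leads.restrictTo_eq {w : List (Option K)} {P Q P' Q' : MvPolynomial (Fin 2) K}
    (h : Leads w P Q P' Q') (hP : P' ≠ 0) (hQ : Q' ≠ 0) :
    restrictTo w P Q = restrictTo [] P' Q' := by
  obtain ⟨M, hM, h1, h2⟩ := h.exists_eq
  rw [← restrictTo_mul_left [] hM hP hQ]
  change algebraMap _ _ (initialPoly _) / algebraMap _ _ (initialPoly _) = _
  rw [h1, h2]
  rfl

/-- If `f` leads over `a` to a point at which it is the quotient of two local coordinates, then the
blow-up of this point creates the only dicritical over `a`, and its degree is one. -/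
theorem Leads.isDicritical_iff {f : MvPolynomial (Fin 2) K} {a : Option K} {w : List (Option K)}
    {P' Q' : MvPolynomial (Fin 2) K} {α β : K} (h : Leads w (germ f a) (poleGerm f) P' Q')
    (hP : HasInitialForm P' 1 (C α * X 0 + C β * X 1))
    (hQ : HasInitialForm Q' 1 (C 1 * X 0 + C 0 * X 1)) (hβ : β ≠ 0) :
    (∀ w', IsDicritical f a w' ↔ w' = w) ∧ dicriticalDegree f a w = 1 := by
  obtain ⟨h1, h2⟩ := isDicriticalPair_of_linear hP hQ hβ
  refine ⟨fun w' => ?_, ?_⟩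
  · rw [AtInfinity.isDicritical_iff, h.isDicriticalPair_iff]
    simp [h1]
  · rw [dicriticalDegree, h.restrictTo_eq hP.right_ne_zero hQ.right_ne_zero, h2,
      RatFunc.num_algebraMap, RatFunc.denom_algebraMap, Polynomial.natDegree_one, add_comm,
      Polynomial.natDegree_linear hβ]
    rfl

/-- A smooth germ with tangent αX₀ + βX₁ = 0 meets the exceptional curve only at slope -α/β, with a
simple zero there. -/
theorem isTypicalAt_of_hasInitialForm {f : MvPolynomial (Fin 2) K} {a : Option K}
    {w : List (Option K)} {t α β : K} (hd : dicriticalDegree f a w = 1)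
    (hF : HasInitialForm (strictTransform w (fibreGerm f a t)) 1 (C α * X 0 + C β * X 1))
    (hβ : β ≠ 0) : IsTypicalAt f a w t := by
  have key : ∀ d, ∃ G, strictTransform (w ++ [d]) (fibreGerm f a t) = G ∧
      restrictExc d G = dehomogenize d (C α * X 0 + C β * X 1) := fun d => by
    obtain ⟨G, h1, h2⟩ := hF.exists_blowUp_eq d
    refine ⟨G, ?_, h2⟩
    rw [strictTransform_append_singleton]
    exact strictStep_eq h1 (h2 ▸ dehomogenize_ne_zero d hF.isHomogeneous hF.ne_zero)
  have hmeets : ∀ d, MeetsAt (fibreGerm f a t) w d ↔ d = some (-α / β) := fun d => by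
    obtain ⟨G, h1, h2⟩ := key d
    rw [MeetsAt, h1, ← coeff_zero_restrictExc d, h2]
    rcases d with _ | c
    · simpa [dehomogenize] using hβ
    · have h3 : (dehomogenize (some c) (C α * X 0 + C β * X 1)).coeff 0 = α + β * c := by
        simp [dehomogenize]
      rw [h3, Option.some_inj, eq_div_iff hβ, mul_comm, add_comm, ← eq_neg_iff_add_eq_zero]
  refine ⟨?_, fun d h => ⟨h, ?_⟩⟩
  · have h1 : {d | MeetsAt (fibreGerm f a t) w d} = {some (-α / β)} := Set.ext hmeets
    rw [h1, Set.encard_singleton, hd]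
    rfl
  · obtain ⟨G, h1, h2⟩ := key d
    rw [h1, ← coeff_one_restrictExc d, h2, (hmeets d).1 h]
    simpa [dehomogenize, Polynomial.coeff_C] using hβ

/-- A strict transform that avoids the centre w misses E_w, so it meets it in 0 points instead of 1.
-/
theorem not_isTypicalAt_of_constantCoeff_ne_zero {f : MvPolynomial (Fin 2) K} {a : Option K}
    {w : List (Option K)} {t : K} (hd : dicriticalDegree f a w = 1)
    (hF : constantCoeff (strictTransform w (fibreGerm f a t)) ≠ 0) : ¬ IsTypicalAt f a w t := by
  rintro ⟨h, -⟩
  have h1 : {d | MeetsAt (fibreGerm f a t) w d} = ∅ := by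
    refine Set.eq_empty_of_forall_notMem fun d hd => ?_
    have h2 : strictStep (strictTransform w (fibreGerm f a t)) d =
        blowUp d (strictTransform w (fibreGerm f a t)) := by
      refine strictStep_eq (n := 0) (by rw [pow_zero, one_mul]) ?_
      rwa [restrictExc_blowUp, Ne, Polynomial.C_eq_zero]
    rw [Set.mem_ofPred_eq, MeetsAt, strictTransform_append_singleton, h2,
      constantCoeff_blowUp] at hd
    exact hF hd
  rw [h1, hd, Set.encard_empty] at h
  simp at h

end

end AtInfinity

/-! ### Resolution over [1:0:0] and the critical value -3/4. -/

namespace AtInfinity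

noncomputable section

open MvPolynomial

variable {K : Type*} [Field K]

section Charts

variable (a c : K)

theorem blowUp_C (d : Option K) : blowUp d (C a) = C a := by
  cases d <;> simp [blowUp]

theorem blowUp_some_X_zero : blowUp (some c) (X 0) = X 0 := by simp [blowUp]

theorem blowUp_some_X_one : blowUp (some c) (X 1) = X 0 * (X 1 + C c) := by simp [blowUp]

theorem blowUp_none_X_zero : blowUp (none : Option K) (X 0) = X 0 * X 1 := by simp [blowUp]

theorem blowUp_none_X_one : blowUp (none : Option K) (X 1) = X 1 := by simp [blowUp]

theorem restrictExc_C (d : Option K) : restrictExc d (C a) = Polynomial.C a := by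
  cases d <;> simp [restrictExc]

theorem restrictExc_none_X_zero : restrictExc (none : Option K) (X 0) = Polynomial.X := by
  simp [restrictExc]

theorem restrictExc_none_X_one : restrictExc (none : Option K) (X 1) = 0 := by
  simp [restrictExc]

end Charts

theorem isHomogeneous_linear_pow (a b : K) (n : ℕ) :
    ((C a * X 0 + C b * X 1 : MvPolynomial (Fin 2) K) ^ n).IsHomogeneous n := by
  simpa using ((isHomogeneous_C_mul_X a (0 : Fin 2)).add (isHomogeneous_C_mul_X b (1 : Fin 2))).pow n

theorem fibreGerm_zero (f : MvPolynomial (Fin 2) K) (a : Option K) :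
    fibreGerm f a 0 = germ f a := by
  rw [fibreGerm, C_0, zero_mul, sub_zero]

theorem hasInitialForm_X_one_pow (n : ℕ) :
    HasInitialForm (X 1 ^ n : MvPolynomial (Fin 2) K) n (X 1 ^ n) :=
  .of_isHomogeneous (isHomogeneous_X_pow 1 n) (pow_ne_zero _ (X_ne_zero _))

/-! ### The points over `[1 : 0 : 0]` -/

/-- The pull-back of the fibre `t` after one blow-up over `[1 : 0 : 0]`. -/
def firstFibre (t : K) : MvPolynomial (Fin 2) K :=
  (X 0 - X 1) ^ 5 - 2 * X 0 ^ 3 * X 1 ^ 3 + 5 * X 0 ^ 2 * X 1 ^ 4 - C (15 / 4) * X 0 * X 1 ^ 5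
    + X 0 * X 1 ^ 6 - C t * X 1 ^ 6

/-- The factor of `X 0` in `chainFibre`. -/
def chainFactor (k : ℕ) (t : K) : MvPolynomial (Fin 2) K :=
  -2 * (1 + X 1) ^ 3 + 5 * (1 + X 1) ^ 4 - C (15 / 4) * (1 + X 1) ^ 5
    + X 0 * X 1 ^ k * (1 + X 1) ^ 6 - C t * (1 + X 1) ^ 6

/-- The pull-back of the fibre `t` after `k + 2` blow-ups over `[1 : 0 : 0]`, for `i + k = 5`. -/
def chainFibre (i k : ℕ) (t : K) : MvPolynomial (Fin 2) K := -X 1 ^ i + X 0 * chainFactor k t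

theorem blowUp_fibreGerm_some_zero (t : K) :
    blowUp none (fibreGerm (p K) (some 0) t) = X 1 ^ 5 * firstFibre t := by
  rw [fibreGerm, germ_p_zero, poleGerm_p, firstFibre]
  simp only [map_add, map_sub, map_mul, map_pow, map_ofNat, blowUp_C, blowUp_none_X_zero,
    blowUp_none_X_one]
  ring

theorem blowUp_firstFibre (t : K) :
    blowUp (some 1) (firstFibre t) = X 0 ^ 5 * chainFibre 5 0 t := by
  rw [firstFibre, chainFibre, chainFactor]
  simp only [map_add, map_sub, map_mul, map_pow, map_ofNat, blowUp_C, blowUp_some_X_zero,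
    blowUp_some_X_one, C_1]
  ring

/-- The blow-up in direction `none` lowers the exponent i by one and raises k by one. At i = 1 the
germ is transversal to X 0 = 0. -/
theorem blowUp_chainFibre (i k : ℕ) (t : K) :
    blowUp none (chainFibre (i + 1) k t) = X 1 ^ 1 * chainFibre i (k + 1) t := by
  rw [chainFibre, chainFibre, chainFactor, chainFactor]
  simp only [map_add, map_sub, map_neg, map_mul, map_pow, map_ofNat, map_one, blowUp_C,
    blowUp_none_X_zero, blowUp_none_X_one]
  ring

/-- This is g(1) - t; its vanishing is what makes t = -3/4 critical. -/
theorem constantCoeff_chainFactor [CharZero K] (k : ℕ) (t : K) :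
    constantCoeff (chainFactor k t) = -3 / 4 - t := by
  simp only [chainFactor, map_add, map_sub, map_neg, map_mul, map_pow, map_ofNat, map_one,
    constantCoeff_X, constantCoeff_C]
  ring

theorem restrictExc_chainFibre (i k : ℕ) (t : K) :
    restrictExc none (chainFibre (i + 1) (k + 1) t) =
      Polynomial.C (constantCoeff (chainFactor 0 t)) * Polynomial.X := by
  simp only [chainFibre, chainFactor, map_add, map_sub, map_neg, map_mul, map_pow, map_ofNat,
    map_one, constantCoeff_X, constantCoeff_C, restrictExc_C, restrictExc_none_X_zero,
    restrictExc_none_X_one]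
  simp only [map_zero]
  ring

theorem dehomogenize_linear_pow_coeff_zero (d : Option K) (a b : K) (n : ℕ) :
    (dehomogenize d ((C a * X 0 + C b * X 1 : MvPolynomial (Fin 2) K) ^ n)).coeff 0 =
      (d.elim b fun c => a + b * c) ^ n := by
  rw [Polynomial.coeff_zero_eq_eval_zero]
  cases d <;> simp [dehomogenize]

theorem linear_pow_ne_zero {a b : K} (h : a ≠ 0 ∨ b ≠ 0) (n : ℕ) :
    ((C a * X 0 + C b * X 1 : MvPolynomial (Fin 2) K) ^ n) ≠ 0 := by
  refine pow_ne_zero _ fun h' => ?_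
  have h1 := congrArg (eval ![1, 0]) h'
  have h2 := congrArg (eval ![0, 1]) h'
  simp at h1 h2
  exact h.elim (· h1) (· h2)

variable [CharZero K]

theorem Leads.cons_linear_pow {P Q P₁ Q₁ P' Q' H' : MvPolynomial (Fin 2) K} {d : Option K}
    {w : List (Option K)} {n m : ℕ} (a b : K)
    (h : Leads w P₁ Q₁ P' Q') (hQ : HasInitialForm Q m H') (hnm : n ≤ m)
    (hc : n = m → ∃ c, (C a * X 0 + C b * X 1) ^ n = C c * H')
    (hd : ∀ d' : Option K, d' ≠ d → d'.elim b (fun c => a + b * c) ≠ 0)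
    (hP₁ : blowUp d P = X (excIndex d) ^ n * P₁)
    (hPr : restrictExc d P₁ = dehomogenize d ((C a * X 0 + C b * X 1) ^ n))
    (hQ₁ : blowUp d Q = X (excIndex d) ^ n * Q₁) : Leads (d :: w) P Q P' Q' := by
  have hab : a ≠ 0 ∨ b ≠ 0 := by
    by_contra! hab
    rcases d with _ | c
    · exact hd (some 0) (by simp) (by simp [hab])
    · exact hd none (by simp) (by simp [hab])
  refine Leads.cons (isHomogeneous_linear_pow a b n) (linear_pow_ne_zero hab n) hQ hnm hc
    (fun d' hd' => ?_) hP₁ hPr hQ₁ h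
  rw [dehomogenize_linear_pow_coeff_zero]
  exact pow_ne_zero _ (hd d' hd')

theorem hasInitialForm_X_mul {G : MvPolynomial (Fin 2) K} (h : constantCoeff G = 1) :
    HasInitialForm (X 0 * G) 1 (C 1 * X 0 + C 0 * X 1) := by
  have := HasInitialForm.linear G 0 (Or.inl (by rw [h]; exact one_ne_zero))
  rwa [h, show X 0 * G + C 0 * X 1 = X 0 * G by simp] at this

theorem Leads.cons_chainFibre {i k : ℕ} {w : List (Option K)} {P' Q' : MvPolynomial (Fin 2) K}
    (h : Leads w (chainFibre (i + 1) (k + 1) 0) (X 0 * (1 + X 1) ^ 6) P' Q') :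
    Leads (none :: w) (chainFibre (i + 2) k 0) (X 0 * (1 + X 1) ^ 6) P' Q' := by
  -- Here i + 2 ≥ 2, so both initial forms are multiples of X 0, and p is constantly -3/4 on the
  -- curve created by this blow-up.
  refine Leads.cons_linear_pow (n := 1) (-3 / 4) 0 h (hasInitialForm_X_mul (by simp)) le_rfl
    (fun _ => ⟨-3 / 4, by simp⟩) ?_ (blowUp_chainFibre _ _ _) ?_ ?_
  · rintro (_ | c) hd
    · exact absurd rfl hd
    · norm_num
  · rw [restrictExc_chainFibre, constantCoeff_chainFactor]
    simp [dehomogenize]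
  · simp only [map_add, map_mul, map_pow, map_one, blowUp_none_X_zero, blowUp_none_X_one]
    change _ = X 1 ^ 1 * _
    ring

theorem leads_some_zero : Leads [none, some 1, none, none, none, none] (germ (p K) (some 0))
    (poleGerm (p K)) (chainFibre 1 4 0) (X 0 * (1 + X 1) ^ 6) := by
  rw [← fibreGerm_zero, poleGerm_p]
  refine Leads.cons_linear_pow (n := 5) (P₁ := firstFibre 0) (Q₁ := X 1 ^ 6) 1 0 ?_
    (hasInitialForm_X_one_pow 11) (by norm_num) (by norm_num) ?_
    (blowUp_fibreGerm_some_zero 0) ?_ ?_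
  rotate_left
  · rintro (_ | c) hd
    · exact absurd rfl hd
    · norm_num
  · simp [firstFibre, restrictExc, dehomogenize]
  · simp [blowUp, excIndex]
    ring
  refine Leads.cons_linear_pow (n := 5) (P₁ := chainFibre 5 0 0) (Q₁ := X 0 * (1 + X 1) ^ 6)
    1 (-1) ?_ (hasInitialForm_X_one_pow 6) (by norm_num) (by norm_num) ?_
    (blowUp_firstFibre 0) ?_ ?_
  rotate_left
  · rintro (_ | c) hd
    · norm_num
    · intro h
      simp only [Option.elim] at h
      exact hd (congrArg some (by linear_combination -h))
  · simp [chainFibre, restrictExc, dehomogenize]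
    ring
  · simp [blowUp, excIndex]
    ring
  exact Leads.nil.cons_chainFibre.cons_chainFibre.cons_chainFibre.cons_chainFibre

theorem hasInitialForm_chainFibre (k : ℕ) (t : K) :
    HasInitialForm (chainFibre 1 k t) 1 (C (-3 / 4 - t) * X 0 + C (-1) * X 1) := by
  have := HasInitialForm.linear (chainFactor k t) (-1) (Or.inr (by norm_num))
  rw [constantCoeff_chainFactor] at this
  convert this using 1
  rw [chainFibre, C_neg, C_1]
  ring

theorem isDicritical_some_zero :
    (∀ w, IsDicritical (p K) (some 0) w ↔ w = [none, some 1, none, none, none, none]) ∧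
      dicriticalDegree (p K) (some 0) [none, some 1, none, none, none, none] = 1 :=
  leads_some_zero.isDicritical_iff (hasInitialForm_chainFibre 4 0)
    (hasInitialForm_X_mul (by simp)) (by norm_num)

theorem strictStep_fibreGerm_some_zero (t : K) :
    strictStep (strictStep (fibreGerm (p K) (some 0) t) none) (some 1) = chainFibre 5 0 t := by
  rw [strictStep_eq (blowUp_fibreGerm_some_zero t), strictStep_eq (blowUp_firstFibre t)]
  · simp [chainFibre, restrictExc]
  · simp [firstFibre, restrictExc]

theorem strictStep_chainFibre (i k : ℕ) {t : K} (ht : t ≠ -3 / 4) :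
    strictStep (chainFibre (i + 2) k t) none = chainFibre (i + 1) (k + 1) t := by
  refine strictStep_eq (blowUp_chainFibre _ _ _) ?_
  rw [restrictExc_chainFibre, constantCoeff_chainFactor]
  refine mul_ne_zero ?_ Polynomial.X_ne_zero
  rw [Ne, Polynomial.C_eq_zero]
  exact sub_ne_zero.2 ht.symm

/-- The strict transforms of the fibre `-3 / 4` over `[1 : 0 : 0]`. -/
def criticalFibre (i k : ℕ) : MvPolynomial (Fin 2) K :=
  -X 1 ^ i + X 0 * ((1 + X 1) ^ 3 * (5 - 21 * C (1 / 4) - 6 * C (1 / 4) * X 1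
    + 3 * C (1 / 4) * X 1 ^ 2)) + X 0 ^ 2 * X 1 ^ k * (1 + X 1) ^ 6

theorem restrictExc_criticalFibre_ne_zero (i k : ℕ) :
    restrictExc none (criticalFibre i k : MvPolynomial (Fin 2) K) ≠ 0 := by
  intro h
  have h0 : restrictExc none (criticalFibre i k : MvPolynomial (Fin 2) K) =
      Polynomial.C (-0 ^ i) + Polynomial.C (5 - 21 * (1 / 4)) * Polynomial.X
        + Polynomial.C (0 ^ k) * Polynomial.X ^ 2 := by
    simp only [criticalFibre, map_add, map_sub, map_neg, map_mul, map_pow, map_ofNat, map_one,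
      restrictExc_C, restrictExc_none_X_zero, restrictExc_none_X_one, map_zero]
    ring
  have h1 := congrArg (Polynomial.coeff · 1) (h0.symm.trans h)
  simp only [Polynomial.coeff_add, Polynomial.coeff_C_mul, Polynomial.coeff_X_one,
    Polynomial.coeff_C_succ, Polynomial.coeff_X_pow, Polynomial.coeff_zero] at h1
  norm_num at h1

theorem strictStep_criticalFibre (i k : ℕ) :
    strictStep (criticalFibre (i + 1) k : MvPolynomial (Fin 2) K) none =
      criticalFibre i (k + 1) := by
  refine strictStep_eq (n := 1) ?_ (restrictExc_criticalFibre_ne_zero _ _)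
  change _ = X 1 ^ 1 * _
  simp only [criticalFibre, map_add, map_sub, map_neg, map_mul, map_pow, map_ofNat, map_one,
    blowUp_C, blowUp_none_X_zero, blowUp_none_X_one]
  ring

/-- For t = -3/4 the factor of X 0 has no constant term, so the multiplicity is 2 and the exponent
of X 1 drops from 5 to 3 in one blow-up. The three remaining ones bring it to 0, where the constant
term -1 shows that the fibre misses the dicritical. -/
theorem strictStep_chainFibre_critical :
    strictStep (chainFibre 5 0 (-3 / 4 : K)) none = criticalFibre 3 0 := by
  refine strictStep_eq (n := 2) ?_ (restrictExc_criticalFibre_ne_zero _ _)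
  have h1 : (C (15 / 4) : MvPolynomial (Fin 2) K) = 15 * C (1 / 4) := by
    rw [← map_ofNat C 15, ← map_mul]
    norm_num
  have h2 : (C (-3 / 4) : MvPolynomial (Fin 2) K) = -3 * C (1 / 4) := by
    rw [← map_ofNat C 3, ← map_neg, ← map_mul]
    norm_num
  have h3 : (4 * C (1 / 4) : MvPolynomial (Fin 2) K) = 1 := by
    rw [← map_ofNat C 4, ← map_mul]
    norm_num
  change _ = X 1 ^ 2 * _
  simp only [chainFibre, chainFactor, criticalFibre, map_add, map_sub, map_neg, map_mul, map_pow,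
    map_ofNat, map_one, blowUp_C, blowUp_none_X_zero, blowUp_none_X_one]
  rw [h1, h2]
  linear_combination -3 * (1 + X 1) ^ 3 * X 0 * X 1 * h3

theorem not_isTypicalAt_some_zero_iff (t : K) :
    ¬ IsTypicalAt (p K) (some 0) [none, some 1, none, none, none, none] t ↔ t = -3 / 4 := by
  constructor
  · intro h
    by_contra ht
    refine h (isTypicalAt_of_hasInitialForm isDicritical_some_zero.2 (α := -3 / 4 - t) (β := -1)
      ?_ (by norm_num))
    simp only [strictTransform_cons, strictStep_fibreGerm_some_zero, strictStep_chainFibre _ _ ht]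
    exact hasInitialForm_chainFibre _ _
  · rintro rfl
    refine not_isTypicalAt_of_constantCoeff_ne_zero isDicritical_some_zero.2 ?_
    simp only [strictTransform_cons, strictStep_fibreGerm_some_zero,
      strictStep_chainFibre_critical, strictStep_criticalFibre]
    simp [strictTransform, criticalFibre]

end

end AtInfinity

/-! ### Resolution over [0:1:0], the critical value -5/8, and the set of critical values. -/

namespace AtInfinity

noncomputable section

open MvPolynomial

variable {K : Type*} [Field K]

/-! ### The points over `[0 : 1 : 0]` -/

/-- The first pull-backs of the fibre `t` over `[0 : 1 : 0]`. -/
def noneFibre : Fin 4 → K → MvPolynomial (Fin 2) K := fun i t =>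
  ![X 0 ^ 6 - 5 * X 0 ^ 5 * X 1 + 10 * X 0 ^ 4 * X 1 ^ 2 - 2 * X 0 ^ 3 * X 1 ^ 2
      - 10 * X 0 ^ 3 * X 1 ^ 3 + 5 * X 0 ^ 2 * X 1 ^ 3 + 5 * X 0 ^ 2 * X 1 ^ 4
      - C (15 / 4) * X 0 * X 1 ^ 4 - X 0 * X 1 ^ 5 + X 1 ^ 4 - C t * X 1 ^ 5,
    X 0 ^ 2 - 5 * X 0 ^ 2 * X 1 + 10 * X 0 ^ 2 * X 1 ^ 2 - 2 * X 0 * X 1 ^ 2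
      - 10 * X 0 ^ 2 * X 1 ^ 3 + 5 * X 0 * X 1 ^ 3 + 5 * X 0 ^ 2 * X 1 ^ 4
      - C (15 / 4) * X 0 * X 1 ^ 4 - X 0 ^ 2 * X 1 ^ 5 + X 1 ^ 4 - C t * (X 0 * X 1 ^ 5),
    X 0 ^ 2 - 5 * X 0 ^ 2 * X 1 + 10 * X 0 ^ 2 * X 1 ^ 2 - 2 * X 0 * X 1
      - 10 * X 0 ^ 2 * X 1 ^ 3 + 5 * X 0 * X 1 ^ 2 + 5 * X 0 ^ 2 * X 1 ^ 4
      - C (15 / 4) * X 0 * X 1 ^ 3 - X 0 ^ 2 * X 1 ^ 5 + X 1 ^ 2 - C t * (X 0 * X 1 ^ 4),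
    X 1 ^ 2 + 5 * X 0 * X 1 * (1 + X 1)
      + X 0 ^ 2 * (10 * (1 + X 1) ^ 2 - C (15 / 4) * (1 + X 1) ^ 3) - 10 * X 0 ^ 3 * (1 + X 1) ^ 3
      + 5 * X 0 ^ 4 * (1 + X 1) ^ 4 - X 0 ^ 5 * (1 + X 1) ^ 5
      - C t * (X 0 ^ 3 * (1 + X 1) ^ 4)] i

theorem blowUp_fibreGerm_none (t : K) :
    blowUp none (fibreGerm (p K) none t) = X 1 ^ 6 * noneFibre 0 t := by
  rw [fibreGerm, germ_p_none, poleGerm_p]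
  simp only [map_add, map_sub, map_mul, map_pow, map_ofNat, blowUp_C, blowUp_none_X_zero,
    blowUp_none_X_one, noneFibre, Matrix.cons_val]
  ring

theorem blowUp_noneFibre_zero (t : K) :
    blowUp (some 0) (noneFibre 0 t) = X 0 ^ 4 * noneFibre 1 t := by
  simp only [map_add, map_sub, map_mul, map_pow, map_ofNat, blowUp_C, blowUp_some_X_zero,
    blowUp_some_X_one, C_0, noneFibre, Matrix.cons_val]
  ring

theorem blowUp_noneFibre_one (t : K) :
    blowUp none (noneFibre 1 t) = X 1 ^ 2 * noneFibre 2 t := by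
  simp only [map_add, map_sub, map_mul, map_pow, map_ofNat, blowUp_C, blowUp_none_X_zero,
    blowUp_none_X_one, noneFibre, Matrix.cons_val]
  ring

theorem blowUp_noneFibre_two (t : K) :
    blowUp (some 1) (noneFibre 2 t) = X 0 ^ 2 * noneFibre 3 t := by
  simp only [map_add, map_sub, map_mul, map_pow, map_ofNat, blowUp_C, blowUp_some_X_zero,
    blowUp_some_X_one, C_1, noneFibre, Matrix.cons_val]
  ring

/-- The factor of `X 0` in the pull-back of the fibre `t` after five blow-ups over `[0 : 1 : 0]`. -/
def lastFactor (t : K) : MvPolynomial (Fin 2) K :=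
  let y := X 1 + C (-5 / 2)
  let v := 1 + X 0 * y
  5 * y ^ 2 + 20 * y + 10 * X 0 * y ^ 2 - C (15 / 4) * (3 * y + 3 * X 0 * y ^ 2 + X 0 ^ 2 * y ^ 3)
    - 10 * v ^ 3 + 5 * X 0 * v ^ 4 - X 0 ^ 2 * v ^ 5 - C t * v ^ 4

theorem blowUp_none_last (F : MvPolynomial (Fin 2) K) :
    blowUp none (X 1 ^ 2 + X 0 * F) = X 1 ^ 1 * (X 0 * blowUp none F + C 1 * X 1) := by
  simp only [map_add, map_mul, map_pow, blowUp_none_X_zero, blowUp_none_X_one, C_1]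
  ring

theorem restrictExc_none_last (F : MvPolynomial (Fin 2) K) :
    restrictExc none (X 0 * blowUp none F + C 1 * X 1) =
      Polynomial.C (constantCoeff F) * Polynomial.X := by
  simp only [map_add, map_mul, restrictExc_blowUp, restrictExc_none_X_zero, restrictExc_none_X_one]
  ring

/-- Applied to `lastFactor` at t = -5/8, where the constant term vanishes; the other coefficients
are not needed. -/
theorem exists_eq_C_add (F : MvPolynomial (Fin 2) K) :
    ∃ G H, F = C (constantCoeff F) + X 0 * G + X 1 * H := by
  induction F using MvPolynomial.induction_on with
  | C c => exact ⟨0, 0, by simp⟩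
  | add F F' h h' =>
    obtain ⟨G, H, h⟩ := h
    obtain ⟨G', H', h'⟩ := h'
    refine ⟨G + G', H + H', ?_⟩
    rw [map_add, map_add]
    linear_combination h + h'
  | mul_X F i _ =>
    fin_cases i
    · exact ⟨F, 0, by simp [mul_comm]⟩
    · exact ⟨0, F, by simp [mul_comm]⟩

variable [CharZero K]

/-- Since 15/4 = 10 - (5/2)^2, the tangent cone X₁^2 + 5X₀X₁ + (10 - 15/4)X₀^2 is the square of X₁ +
(5/2)X₀, which leaves the single direction -5/2. -/
theorem blowUp_noneFibre_three (t : K) :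
    blowUp (some (-5 / 2)) (noneFibre 3 t) = X 0 ^ 2 * (X 1 ^ 2 + X 0 * lastFactor t) := by
  have h1 : (2 * C (-5 / 2) : MvPolynomial (Fin 2) K) = -5 := by
    rw [← map_ofNat C 2, ← map_mul, ← map_ofNat C 5, ← map_neg]
    norm_num
  have h2 : (C (15 / 4) : MvPolynomial (Fin 2) K) = 10 - C (-5 / 2) ^ 2 := by
    rw [← map_ofNat C 10, ← map_pow, ← map_sub]
    norm_num
  simp only [map_add, map_sub, map_mul, map_pow, map_ofNat, map_one, blowUp_C, blowUp_some_X_zero,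
    blowUp_some_X_one, noneFibre, lastFactor, Matrix.cons_val]
  linear_combination X 0 ^ 2 * (X 1 + C (-5 / 2)) * h1 - X 0 ^ 2 * h2

theorem constantCoeff_lastFactor (t : K) : constantCoeff (lastFactor t) = -5 / 8 - t := by
  simp only [lastFactor, map_add, map_sub, map_mul, map_pow, map_ofNat, map_one, constantCoeff_X,
    constantCoeff_C]
  ring

theorem leads_none : Leads [none, some 0, none, some 1, some (-5 / 2), none] (germ (p K) none)
    (poleGerm (p K)) (X 0 * blowUp none (lastFactor 0) + C 1 * X 1)
    (X 0 * blowUp none ((1 + X 0 * (X 1 + C (-5 / 2))) ^ 4)) := by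
  have hX : ∀ i, HasInitialForm (X 0 * X 1 ^ i : MvPolynomial (Fin 2) K) (1 + i) (X 0 * X 1 ^ i) :=
    fun i => .of_isHomogeneous ((isHomogeneous_X _ _).mul (isHomogeneous_X_pow 1 i))
      (mul_ne_zero (X_ne_zero _) (pow_ne_zero _ (X_ne_zero _)))
  rw [← fibreGerm_zero, poleGerm_p]
  refine Leads.cons_linear_pow (n := 6) (P₁ := noneFibre 0 0) (Q₁ := X 1 ^ 5) 1 0 ?_
    (hasInitialForm_X_one_pow 11) (by norm_num) (by norm_num) ?_
    (blowUp_fibreGerm_none 0) ?_ ?_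
  rotate_left
  · rintro (_ | c) hd
    · exact absurd rfl hd
    · norm_num
  · simp [noneFibre, restrictExc, dehomogenize]
  · simp [blowUp, excIndex]
    ring
  refine Leads.cons_linear_pow (n := 4) (P₁ := noneFibre 1 0) (Q₁ := X 0 * X 1 ^ 5) 0 1 ?_
    (hasInitialForm_X_one_pow 5) (by norm_num) (by norm_num) ?_
    (blowUp_noneFibre_zero 0) ?_ ?_
  rotate_left
  · rintro (_ | c) hd
    · norm_num
    · simpa using hd
  · simp [noneFibre, restrictExc, dehomogenize]
  · simp [blowUp, excIndex]
    ring
  refine Leads.cons_linear_pow (n := 2) (P₁ := noneFibre 2 0) (Q₁ := X 0 * X 1 ^ 4) 1 0 ?_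
    (hX 5) (by norm_num) (by norm_num) ?_ (blowUp_noneFibre_one 0) ?_ ?_
  rotate_left
  · rintro (_ | c) hd
    · exact absurd rfl hd
    · norm_num
  · simp [noneFibre, restrictExc, dehomogenize]
  · simp [blowUp, excIndex]
    ring
  refine Leads.cons_linear_pow (n := 2) (P₁ := noneFibre 3 0) (Q₁ := X 0 ^ 3 * (1 + X 1) ^ 4)
    1 (-1) ?_ (hX 4) (by norm_num) (by norm_num) ?_ (blowUp_noneFibre_two 0) ?_ ?_
  rotate_left
  · rintro (_ | c) hd
    · norm_num
    · intro h
      simp only [Option.elim] at h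
      exact hd (congrArg some (by linear_combination -h))
  · simp [noneFibre, restrictExc, dehomogenize]
  · simp [blowUp, excIndex]
    ring
  refine Leads.cons_linear_pow (n := 2) (P₁ := X 1 ^ 2 + X 0 * lastFactor 0)
    (Q₁ := X 0 * (1 + X 0 * (X 1 + C (-5 / 2))) ^ 4) (5 / 2) 1 ?_
    ((HasInitialForm.of_isHomogeneous (isHomogeneous_X_pow 0 3)
      (pow_ne_zero _ (X_ne_zero _))).mul (.of_constantCoeff_ne_zero (by simp)))
    (by norm_num) (by norm_num) ?_ (blowUp_noneFibre_three 0) ?_ ?_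
  rotate_left
  · rintro (_ | c) hd
    · norm_num
    · intro h
      simp only [Option.elim] at h
      exact hd (congrArg some (by linear_combination h))
  · simp [restrictExc, dehomogenize]
    rw [add_left_comm, ← map_add]
    norm_num
  · simp only [map_mul, map_pow, map_add, map_one, blowUp_some_X_zero, blowUp_some_X_one]
    change _ = X 0 ^ 2 * _
    ring
  -- Both initial forms are multiples of X 0: on the last curve before the dicritical, p is
  -- constantly -5/8.
  refine Leads.cons_linear_pow (n := 1) (-5 / 8) 0 Leads.nil (hasInitialForm_X_mul (by simp))
    le_rfl (fun _ => ⟨-5 / 8, by simp⟩) ?_ (blowUp_none_last _) ?_ ?_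
  · rintro (_ | c) hd
    · exact absurd rfl hd
    · norm_num
  · rw [restrictExc_none_last, constantCoeff_lastFactor]
    simp [dehomogenize]
  · rw [map_mul, blowUp_none_X_zero]
    change _ = X 1 ^ 1 * _
    ring

theorem hasInitialForm_last (t : K) :
    HasInitialForm (X 0 * blowUp none (lastFactor t) + C 1 * X 1) 1
      (C (-5 / 8 - t) * X 0 + C 1 * X 1) := by
  have := HasInitialForm.linear (blowUp none (lastFactor t)) 1 (Or.inr one_ne_zero)
  rwa [constantCoeff_blowUp, constantCoeff_lastFactor] at this

theorem isDicritical_none :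
    (∀ w, IsDicritical (p K) none w ↔ w = [none, some 0, none, some 1, some (-5 / 2), none]) ∧
      dicriticalDegree (p K) none [none, some 0, none, some 1, some (-5 / 2), none] = 1 :=
  leads_none.isDicritical_iff (hasInitialForm_last 0)
    (hasInitialForm_X_mul (by rw [constantCoeff_blowUp]; simp)) one_ne_zero

theorem strictStep_fibreGerm_none (t : K) :
    strictStep (strictStep (strictStep (strictStep (strictStep (fibreGerm (p K) none t) none)
      (some 0)) none) (some 1)) (some (-5 / 2)) = X 1 ^ 2 + X 0 * lastFactor t := by
  rw [strictStep_eq (blowUp_fibreGerm_none t), strictStep_eq (blowUp_noneFibre_zero t),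
    strictStep_eq (blowUp_noneFibre_one t), strictStep_eq (blowUp_noneFibre_two t),
    strictStep_eq (blowUp_noneFibre_three t)] <;> simp [noneFibre, restrictExc]

/-- At t = -5/8 the germ X₁^2 + X₀ · `lastFactor` has multiplicity 2 instead of 1, and X₁^2 is part
of its tangent cone. In the direction `none` its strict transform is therefore a unit. -/
theorem exists_strictStep_last_critical : ∃ G : MvPolynomial (Fin 2) K,
    strictStep (X 1 ^ 2 + X 0 * lastFactor (-5 / 8)) none = 1 + X 0 * G := by
  obtain ⟨G, H, h⟩ := exists_eq_C_add (lastFactor (-5 / 8 : K))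
  rw [constantCoeff_lastFactor, sub_self, C_0, zero_add] at h
  refine ⟨X 0 * blowUp none G + blowUp none H, strictStep_eq (n := 2) ?_ ?_⟩
  · rw [h]
    simp only [map_add, map_mul, map_pow, blowUp_none_X_zero, blowUp_none_X_one]
    change _ = X 1 ^ 2 * _
    ring
  · intro h1
    have h2 := congrArg (Polynomial.coeff · 0) h1
    simp only [coeff_zero_restrictExc] at h2
    simp at h2

theorem not_isTypicalAt_none_iff (t : K) :
    ¬ IsTypicalAt (p K) none [none, some 0, none, some 1, some (-5 / 2), none] t ↔
      t = -5 / 8 := by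
  constructor
  · intro h
    by_contra ht
    refine h (isTypicalAt_of_hasInitialForm isDicritical_none.2 (α := -5 / 8 - t) (β := 1)
      ?_ one_ne_zero)
    rw [strictTransform_cons, strictTransform_cons, strictTransform_cons, strictTransform_cons,
      strictTransform_cons, strictTransform_cons, strictStep_fibreGerm_none,
      strictStep_eq (blowUp_none_last _)]
    · exact hasInitialForm_last t
    · rw [restrictExc_none_last, constantCoeff_lastFactor]
      refine mul_ne_zero ?_ Polynomial.X_ne_zero
      rw [Ne, Polynomial.C_eq_zero]
      exact sub_ne_zero.2 (Ne.symm ht)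
  · rintro rfl
    refine not_isTypicalAt_of_constantCoeff_ne_zero isDicritical_none.2 ?_
    obtain ⟨G, hG⟩ := exists_strictStep_last_critical (K := K)
    rw [strictTransform_cons, strictTransform_cons, strictTransform_cons, strictTransform_cons,
      strictTransform_cons, strictTransform_cons, strictStep_fibreGerm_none, hG]
    simp [strictTransform]

/-! ### The critical values at infinity -/

theorem not_isDicritical_some {c : K} (hc : c ≠ 0) (w : List (Option K)) :
    ¬ IsDicritical (p K) (some c) w := by
  refine not_isDicriticalPair_of_constantCoeff_ne_zero w ?_ ?_
  · rw [poleGerm_p]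
    exact pow_ne_zero _ (X_ne_zero _)
  · rw [← fibreGerm_zero, constantCoeff_fibreGerm_some]
    exact pow_ne_zero _ hc

theorem isDicritical_p_iff (a : Option K) (w : List (Option K)) : IsDicritical (p K) a w ↔
    (a = none ∧ w = [none, some 0, none, some 1, some (-5 / 2), none]) ∨
      (a = some 0 ∧ w = [none, some 1, none, none, none, none]) := by
  rcases a with _ | c
  · simp [isDicritical_none.1]
  · rcases eq_or_ne c 0 with rfl | hc
    · simp [isDicritical_some_zero.1]
    · simp [not_isDicritical_some hc, hc]

theorem isCriticalValueAtInfinity_p_iff (t : K) :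
    IsCriticalValueAtInfinity (p K) t ↔ t = -5 / 8 ∨ t = -3 / 4 := by
  rw [IsCriticalValueAtInfinity, ← not_isTypicalAt_none_iff, ← not_isTypicalAt_some_zero_iff]
  constructor
  · rintro ⟨a, w, hw, h⟩
    rcases (isDicritical_p_iff a w).1 hw with ⟨rfl, rfl⟩ | ⟨rfl, rfl⟩
    · exact Or.inl h
    · exact Or.inr h
  · rintro (h | h)
    · exact ⟨_, _, (isDicritical_p_iff _ _).2 (Or.inl ⟨rfl, rfl⟩), h⟩
    · exact ⟨_, _, (isDicritical_p_iff _ _).2 (Or.inr ⟨rfl, rfl⟩), h⟩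

theorem setOf_isCriticalValueAtInfinity_p :
    {t : K | IsCriticalValueAtInfinity (p K) t} = {-5 / 8, -3 / 4} :=
  Set.ext fun t => isCriticalValueAtInfinity_p_iff t

theorem encard_nonzero_criticalValues :
    {t : K | t ≠ 0 ∧ IsCriticalValueAtInfinity (p K) t}.encard = 2 := by
  have h : {t : K | t ≠ 0 ∧ IsCriticalValueAtInfinity (p K) t} = {-5 / 8, -3 / 4} := by
    ext t
    rw [Set.mem_ofPred_eq, isCriticalValueAtInfinity_p_iff, Set.mem_insert_iff,
      Set.mem_singleton_iff]
    refine and_iff_right_of_imp ?_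
    rintro (rfl | rfl) <;> norm_num
  rw [h, Set.encard_pair (by norm_num)]

end

end AtInfinity

theorem mainTheorem10 (K : Type*) [Field K] [IsAlgClosed K] [CharZero K] :
    -- the second expression of the polynomial
    (AtInfinity.p K =
      ((MvPolynomial.X 0 ^ 3 * MvPolynomial.X 1 ^ 2 - 1) ^ 2 * MvPolynomial.X 1
        + (MvPolynomial.X 0 * MvPolynomial.X 1 - 1) ^ 5 * MvPolynomial.X 0
        - MvPolynomial.X 0 ^ 6 * MvPolynomial.X 1 ^ 5
        + 5 * MvPolynomial.X 0 * MvPolynomial.X 1 *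
          (MvPolynomial.X 0 * MvPolynomial.X 1 - MvPolynomial.C (3 / 4)))) ∧
    -- the dicriticals at infinity, one over `[0 : 1 : 0]` and one over `[1 : 0 : 0]`
    (∃ w₁ w₂ : List (Option K),
      (∀ a w, AtInfinity.IsDicritical (AtInfinity.p K) a w ↔
        (a = none ∧ w = w₁) ∨ (a = some 0 ∧ w = w₂)) ∧
      AtInfinity.dicriticalDegree (AtInfinity.p K) none w₁ = 1 ∧
      AtInfinity.dicriticalDegree (AtInfinity.p K) (some 0) w₂ = 1 ∧
      (∀ t, ¬ AtInfinity.IsTypicalAt (AtInfinity.p K) none w₁ t ↔ t = -5 / 8) ∧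
      (∀ t, ¬ AtInfinity.IsTypicalAt (AtInfinity.p K) (some 0) w₂ t ↔ t = -3 / 4)) ∧
    -- the critical values at infinity
    {t | AtInfinity.IsCriticalValueAtInfinity (AtInfinity.p K) t} = {-5 / 8, -3 / 4} ∧
    {t | t ≠ 0 ∧ AtInfinity.IsCriticalValueAtInfinity (AtInfinity.p K) t}.encard = 2 ∧
    -- the branches at infinity of the curve `p = 0`, and the bound is attained
    (AtInfinity.branchesAtInfinity (AtInfinity.p K)).encard = 2 ∧
    {t | t ≠ 0 ∧ AtInfinity.IsCriticalValueAtInfinity (AtInfinity.p K) t}.encard =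
      (AtInfinity.branchesAtInfinity (AtInfinity.p K)).encard ∧
    -- the branches at infinity of the other fibres
    (∀ t : K, t ≠ -5 / 8 → t ≠ -3 / 4 →
      (AtInfinity.branchesAtInfinity (AtInfinity.p K - MvPolynomial.C t)).encard = 2) ∧
    (AtInfinity.branchesAtInfinity (AtInfinity.p K - MvPolynomial.C (-5 / 8))).encard = 3 ∧
    (AtInfinity.branchesAtInfinity (AtInfinity.p K - MvPolynomial.C (-3 / 4))).encard = 3 ∧
    -- the affine singularities of the fibres
    (∀ v : Fin 2 → K,
      AtInfinity.IsSingularAt (AtInfinity.p K) v ↔ v = ![-900, -4 / 3375]) ∧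
    AtInfinity.IsOrdinaryDoublePoint (AtInfinity.p K) ![-900, -4 / 3375] ∧
    MvPolynomial.eval ![-900, -4 / 3375] (AtInfinity.p K) = -20 / 27 := by
  exact ⟨AtInfinity.p_eq,
    ⟨_, _, AtInfinity.isDicritical_p_iff, AtInfinity.isDicritical_none.2,
      AtInfinity.isDicritical_some_zero.2, AtInfinity.not_isTypicalAt_none_iff,
      AtInfinity.not_isTypicalAt_some_zero_iff⟩,
    AtInfinity.setOf_isCriticalValueAtInfinity_p,
    AtInfinity.encard_nonzero_criticalValues,
    AtInfinity.encard_branchesAtInfinity_p,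
    AtInfinity.encard_nonzero_criticalValues.trans AtInfinity.encard_branchesAtInfinity_p.symm,
    fun _ => AtInfinity.encard_branchesAtInfinity_eq_two,
    AtInfinity.encard_branchesAtInfinity_first,
    AtInfinity.encard_branchesAtInfinity_second,
    AtInfinity.isSingularAt_p_iff_eq,
    AtInfinity.isOrdinaryDoublePoint_p,
    AtInfinity.eval_p_singular⟩
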